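/- Let $\Gamma$ be a metrized graph: a finite connected graph (loops and multiple edges allowed) with vertex set $V(\Gamma)\neq\emptyset$ and edges $e_1,\dots,e_k$, in which the edge $e_i$ is identified with a segment of length $L_i>0$; $\Gamma$ is also regarded as the topological space obtained by gluing these segments at their end points. Put $\ell(\Gamma)=\sum_i L_i$. For $y,z\in\Gamma$ let $x\mapsto j_z(x,y)$ be the voltage function, i.e. the unique continuous piecewise affine function on $\Gamma$ with $j_z(z,y)=0$ and $\Delta_x j_z(x,y)=\delta_y-\delta_z$, where for a piecewise affine $f$ one sets $\Delta f=-\sum_{p}\big(\sum_{\vec v\text{ at }p}d_{\vec v}f(p)\big)\delta_p$, the inner sum being over all directions $\vec v$ emanating from $p$. The effective resistance is $r(x,y)=j_x(y,y)$. The canonical measure $\mu_{can}$ is the unique real signed Borel measure $\mu$ on $\Gamma$ with $\mu(\Gamma)=1$ for which $j_\mu(x,x)$ is constant in $x\in\Gamma$, where $j_\mu(x,y)=\int_\Gamma j_\zeta(x,y)\,d\mu(\zeta)$; the tau constant is $\tau(\Gamma)=\tfrac12 j_{\mu_{can}}(x,x)$. Let $R_i\in[0,\infty]$ be the effective resistance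 between the end points of $e_i$ in the graph $\Gamma-e_i$ obtained by deleting the interior of $e_i$, with $R_i=\infty$ if $\Gamma-e_i$ is disconnected, in which case $\frac{L_i^2}{L_i+R_i}$ is read as $0$. For an integer $n\ge 2$ let $\Gamma^{DA,n}$ be the metrized graph with the same vertices obtained from $\Gamma$ by replacing each edge $e_i$ by $n$ parallel edges, each of length $L_i/n$ and with the same end points as $e_i$. Then \[ \tau(\Gamma^{DA,n})=\frac{\tau(\Gamma)}{n^2}+\frac{\ell(\Gamma)}{12}\Big(\frac{n-1}{n}\Big)^2+\frac{n-1}{6n^2}\sum_{i=1}^{k}\frac{L_i^2}{L_i+R_i}. \] -/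

import Mathlib

open Set Topology MeasureTheory

noncomputable section

/-- A finite multigraph (loops and multiple edges allowed) with vertices `V` and edges `E`, in
which the edge `e` is parametrized by the closed segment `[0, len e]`, running from `src e` to
`tgt e`. The orientation only fixes the parametrization. A metrized graph is such a datum that is
connected in the sense of `MetrizedGraph.Connected`; connectedness is a separate predicate because
deleting an edge may destroy it. -/
structure MetrizedGraph (V E : Type*) where
  src : E → V
  tgt : E → V
  len : E → ℝ
  len_pos : ∀ e, 0 < len e

namespace MetrizedGraph

variable {V E : Type*}

/-- The graph is non-empty and any two vertices are joined by a path of edges. -/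
def Connected (Γ : MetrizedGraph V E) : Prop :=
  (SimpleGraph.fromRel fun u v => ∃ e, Γ.src e = u ∧ Γ.tgt e = v).Connected

/-- The points of the graph as a one-dimensional space: vertices and interior points of edges. -/
inductive Point (Γ : MetrizedGraph V E)
  | vertex (v : V) : Point Γ
  | interior (e : E) (t : Ioo (0 : ℝ) (Γ.len e)) : Point Γ

/-- The parametrization of the edge `e` by `[0, len e]`, extended to `ℝ` by constants. -/
def path (Γ : MetrizedGraph V E) (e : E) (t : ℝ) : Γ.Point :=
  open scoped Classical in
  if h : t ∈ Ioo (0 : ℝ) (Γ.len e) then .interior e ⟨t, h⟩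
  else if t ≤ 0 then .vertex (Γ.src e)
  else .vertex (Γ.tgt e)

/-- The topology obtained by gluing the segments `[0, len e]` at their end points: a set is open
iff its preimage under each edge parametrization is open. -/
instance (Γ : MetrizedGraph V E) : TopologicalSpace Γ.Point :=
  ⨆ e : E, TopologicalSpace.coinduced (Γ.path e) inferInstance

instance (Γ : MetrizedGraph V E) : MeasurableSpace Γ.Point := borel Γ.Point

instance (Γ : MetrizedGraph V E) : BorelSpace Γ.Point := ⟨rfl⟩

/-- A continuous function on `Γ` that is affine on each of finitely many segments making up the
edges, i.e. is locally affine off a finite set of points (which may be enlarged to a vertex set). -/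
def IsPiecewiseAffine (Γ : MetrizedGraph V E) (f : Γ.Point → ℝ) : Prop :=
  Continuous f ∧ ∃ S : Set Γ.Point, S.Finite ∧
    ∀ (e : E), ∀ t ∈ Ioo (0 : ℝ) (Γ.len e), Γ.path e t ∉ S →
      ∃ a b : ℝ, ∀ᶠ s in 𝓝 t, f (Γ.path e s) = a * s + b

/-- The derivative of `f` along the edge `e` at the parameter `t`, in the direction of
increasing parameter. -/
def forwardDeriv (Γ : MetrizedGraph V E) (f : Γ.Point → ℝ) (e : E) (t : ℝ) : ℝ :=
  derivWithin (fun s => f (Γ.path e s)) (Ici t) t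

/-- The derivative of `f` along the edge `e` at the parameter `t`, in the direction of
decreasing parameter. -/
def backwardDeriv (Γ : MetrizedGraph V E) (f : Γ.Point → ℝ) (e : E) (t : ℝ) : ℝ :=
  -derivWithin (fun s => f (Γ.path e s)) (Iic t) t

/-- The sum of the derivatives of `f` at a point, over all directions emanating from that point.
A loop at a vertex contributes two directions. -/
def slopeSum [Fintype E] (Γ : MetrizedGraph V E) (f : Γ.Point → ℝ) : Γ.Point → ℝ
  | .vertex v =>
      open scoped Classical in
      ∑ e : E, ((if Γ.src e = v then Γ.forwardDeriv f e 0 else 0) +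
        (if Γ.tgt e = v then Γ.backwardDeriv f e (Γ.len e) else 0))
  | .interior e t => Γ.forwardDeriv f e t + Γ.backwardDeriv f e t

/-- `f` is the voltage function `x ↦ j_z(x, y)`: it vanishes at `z`, is continuous and piecewise
affine, and satisfies `Δ f = δ_y - δ_z`. For piecewise affine `f` the Laplacian is the discrete
measure `Δ f = - ∑_p (slopeSum f p) δ_p`, so that this is an identity of point masses. -/
def IsVoltage [Fintype E] (Γ : MetrizedGraph V E) (z y : Γ.Point) (f : Γ.Point → ℝ) : Prop :=
  open scoped Classical in
  Γ.IsPiecewiseAffine f ∧ f z = 0 ∧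
    ∀ p, -Γ.slopeSum f p = (if p = y then 1 else 0) - (if p = z then 1 else 0)

/-- The voltage function `j_z(x, y)`: the voltage at `x`, relative to `z`, when unit current enters
at `y` and exits at `z`, edge lengths being resistances. On a connected finite graph it is the value
at `x` of the unique function satisfying `IsVoltage z y`. -/
def voltage [Fintype E] (Γ : MetrizedGraph V E) (z x y : Γ.Point) : ℝ :=
  Classical.epsilon (fun f => Γ.IsVoltage z y f) x

/-- The effective resistance `r(x, y) = j_x(y, y)`. -/
def resistance [Fintype E] (Γ : MetrizedGraph V E) (x y : Γ.Point) : ℝ := Γ.voltage x y y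

/-- `j_μ(x, y) = ∫ j_ζ(x, y) dμ(ζ)` for a finite signed Borel measure `μ`. -/
def voltageAvg [Fintype E] (Γ : MetrizedGraph V E) (μ : SignedMeasure Γ.Point)
    (x y : Γ.Point) : ℝ :=
  ∫ᵛ ζ, Γ.voltage ζ x y ∂<•μ

/-- `μ` has total mass `1` and `j_μ(x, x)` is constant on `Γ`. -/
def IsCanonicalMeasure [Fintype E] (Γ : MetrizedGraph V E) (μ : SignedMeasure Γ.Point) : Prop :=
  μ univ = 1 ∧ ∃ c : ℝ, ∀ x, Γ.voltageAvg μ x x = c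

/-- The canonical measure: the unique signed Borel measure `μ` of total mass `1` with `j_μ(x, x)`
constant. -/
def canonicalMeasure [Fintype E] (Γ : MetrizedGraph V E) : SignedMeasure Γ.Point :=
  Classical.epsilon fun μ => Γ.IsCanonicalMeasure μ

/-- The tau constant: half the constant value of `j_μ(x, x)`, where `μ` is the canonical measure. -/
def tau [Fintype E] (Γ : MetrizedGraph V E) : ℝ :=
  Classical.epsilon fun t => ∀ x, (1 / 2) * Γ.voltageAvg Γ.canonicalMeasure x x = t

/-- The total length `ℓ(Γ)`. -/
def totalLength [Fintype E] (Γ : MetrizedGraph V E) : ℝ := ∑ e, Γ.len e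

/-- The graph `Γ - e`, in which the interior points of the edge `e` are removed. -/
def deleteEdge (Γ : MetrizedGraph V E) (e : E) : MetrizedGraph V {e' : E // e' ≠ e} where
  src e' := Γ.src e'
  tgt e' := Γ.tgt e'
  len e' := Γ.len e'
  len_pos e' := Γ.len_pos e'

/-- `R_e`: the effective resistance between the end points of `e` in `Γ - e`, and `∞` if `Γ - e` is
disconnected. -/
def coResistance [Fintype E] [DecidableEq E] (Γ : MetrizedGraph V E) (e : E) : ENNReal :=
  open scoped Classical in
  if (Γ.deleteEdge e).Connected then
    ENNReal.ofReal ((Γ.deleteEdge e).resistance (.vertex (Γ.src e)) (.vertex (Γ.tgt e)))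
  else ⊤

/-- `Γ^{DA,n}`: every edge of length `L` is replaced by `n` parallel edges of length `L / n`. -/
def multiplyEdges (Γ : MetrizedGraph V E) (n : ℕ) : MetrizedGraph V (E × Fin n) where
  src e := Γ.src e.1
  tgt e := Γ.tgt e.1
  len e := Γ.len e.1 / n
  len_pos e := div_pos (Γ.len_pos e.1) (Nat.cast_pos.mpr e.2.pos)

end MetrizedGraph

end

/-! ### Connectedness of finite multigraphs -/

noncomputable section

namespace MetrizedGraph

variable {V E : Type*}

/-! Write r(u,v) for effective resistance in Γ and r_e for its value at the two ends e⁻, e⁺ of e.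
Everything rests on a formula valid for any base vertex p (`IsGreen.tau_eq`): 2τ(Γ) = Σ_v r(p,v) − ½
Σ_e (r_e/L_e)(r(p,e⁻) + r(p,e⁺)) + (1/6) Σ_e (L_e − r_e)²/L_e. In Γ^{DA,n} the conductance 1/L_e is
replaced by n conductances n/L_e, so the vertex Laplacian is multiplied by n² and vertex resistances
are divided by n². The first two sums are then divided by n², while the third becomes Σ_e ((L_e −
r_e) + (n−1)L_e)²/(n²L_e). Expanding the square gives the claim, since L_e − r_e = L_e²/(L_e + R_e)
by the law of parallel resistances, both sides being 0 for a bridge.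

To obtain the formula, invert the vertex Laplacian up to a uniform background charge, and extend the
resulting kernel to a Green function G on Γ: bilinear interpolation along edges plus the Dirichlet
Green function of each edge. Uniqueness of voltages gives r(x,y) = G(x,x) − 2G(x,y) + G(y,y). The
Chinburg–Rumely measure μ, with masses 1 − deg(v)/2 at vertices and density (L_e − r_e)/L_e² on
edges, satisfies ∫ G(x,y) dμ(x) = ½ G(y,y) + K, so ∫ r(x,y) dμ(x) is independent of y.

Uniqueness of the canonical measure is bypassed: if ν also has mass 1 and constant potential, Fubini
applied to ∬ r dμ dν identifies the two constants. Hence τ is half the constant of μ, which is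
evaluated at y = p. -/

theorem eq_of_reachable {α : Type*} {Γ : MetrizedGraph V E} {f : V → α}
    (hf : ∀ e, f (Γ.src e) = f (Γ.tgt e)) {u v : V}
    (h : (SimpleGraph.fromRel fun u v => ∃ e, Γ.src e = u ∧ Γ.tgt e = v).Reachable u v) :
    f u = f v := by
  obtain ⟨w⟩ := h
  induction w with
  | nil => rfl
  | cons hadj _ ih =>
    rw [← ih]
    rw [SimpleGraph.fromRel_adj] at hadj
    obtain ⟨-, ⟨e, rfl, rfl⟩ | ⟨e, rfl, rfl⟩⟩ := hadj
    · exact hf e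
    · exact (hf e).symm

theorem Connected.eq {α : Type*} {Γ : MetrizedGraph V E} (hΓ : Γ.Connected) {f : V → α}
    (hf : ∀ e, f (Γ.src e) = f (Γ.tgt e)) (u v : V) : f u = f v :=
  eq_of_reachable hf (hΓ.preconnected u v)

theorem reachable_src_tgt (Γ : MetrizedGraph V E) (e : E) :
    (SimpleGraph.fromRel fun u v => ∃ e, Γ.src e = u ∧ Γ.tgt e = v).Reachable
      (Γ.src e) (Γ.tgt e) := by
  by_cases h : Γ.src e = Γ.tgt e
  · rw [h]
  · exact SimpleGraph.Adj.reachable ((SimpleGraph.fromRel_adj _ _ _).2 ⟨h, Or.inl ⟨e, rfl, rfl⟩⟩)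

/-- If the ends of e were still joined in Γ − e, the property of being reachable in Γ − e from x
would be constant across every edge of Γ, hence on all of V. -/
theorem Connected.not_reachable_of_not_connected_deleteEdge [DecidableEq E] {Γ : MetrizedGraph V E}
    {e : E} (hΓ : Γ.Connected)
    (h : ¬(Γ.deleteEdge e).Connected) :
    ¬(SimpleGraph.fromRel fun u v => ∃ e', (Γ.deleteEdge e).src e' = u ∧
      (Γ.deleteEdge e).tgt e' = v).Reachable (Γ.src e) (Γ.tgt e) := by
  intro hr
  refine h ((SimpleGraph.connected_iff _).2 ⟨fun x y => ?_, hΓ.nonempty⟩)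
  refine (hΓ.eq (f := fun w => (SimpleGraph.fromRel fun u v => ∃ e', (Γ.deleteEdge e).src e' = u ∧
      (Γ.deleteEdge e).tgt e' = v).Reachable x w) (fun e' => ?_) x y).mp (SimpleGraph.Reachable.refl x)
  have : (SimpleGraph.fromRel fun u v => ∃ e', (Γ.deleteEdge e).src e' = u ∧
      (Γ.deleteEdge e).tgt e' = v).Reachable (Γ.src e') (Γ.tgt e') := by
    by_cases he : e' = e
    · rwa [he]
    · exact (Γ.deleteEdge e).reachable_src_tgt ⟨e', he⟩
  exact propext ⟨fun h => h.trans this, fun h => h.trans this.symm⟩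

theorem Connected.multiplyEdges {Γ : MetrizedGraph V E} (hΓ : Γ.Connected) {n : ℕ} (hn : n ≠ 0) :
    (Γ.multiplyEdges n).Connected := by
  unfold Connected at hΓ ⊢
  convert hΓ using 5 with u v
  constructor
  · rintro ⟨e, he⟩
    exact ⟨e.1, he⟩
  · rintro ⟨e, he⟩
    exact ⟨(e, ⟨0, Nat.pos_of_ne_zero hn⟩), he⟩

/-! ### The vertex Laplacian, its Green function and vertex resistances -/

/-- The Laplacian on functions on the vertices, with conductances `1 / len e`. -/
def lap [Fintype E] (Γ : MetrizedGraph V E) (a : V → ℝ) (v : V) : ℝ :=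
  open scoped Classical in
  ∑ e, ((if Γ.src e = v then (a (Γ.src e) - a (Γ.tgt e)) / Γ.len e else 0) +
    (if Γ.tgt e = v then (a (Γ.tgt e) - a (Γ.src e)) / Γ.len e else 0))

section Discrete

variable [Fintype E] (Γ : MetrizedGraph V E)

/-- Summation by parts: the Dirichlet form, from which self-adjointness, positivity and vanishing
total charge all follow. -/
theorem sum_mul_lap [Fintype V] (a b : V → ℝ) :
    ∑ v, b v * Γ.lap a v =
      ∑ e, (b (Γ.src e) - b (Γ.tgt e)) * (a (Γ.src e) - a (Γ.tgt e)) / Γ.len e := by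
  classical
  simp only [lap, Finset.mul_sum]
  rw [Finset.sum_comm]
  refine Finset.sum_congr rfl fun e _ => ?_
  simp only [mul_add, mul_ite, mul_zero, Finset.sum_add_distrib, Finset.sum_ite_eq,
    Finset.mem_univ, if_true]
  ring

theorem sum_mul_lap_comm [Fintype V] (a b : V → ℝ) :
    ∑ v, b v * Γ.lap a v = ∑ v, a v * Γ.lap b v := by
  rw [sum_mul_lap, sum_mul_lap]
  exact Finset.sum_congr rfl fun e _ => by ring

theorem sum_lap [Fintype V] (a : V → ℝ) : ∑ v, Γ.lap a v = 0 := by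
  simpa using Γ.sum_mul_lap a fun _ => 1

theorem sum_mul_lap_self_nonneg [Fintype V] (a : V → ℝ) : 0 ≤ ∑ v, a v * Γ.lap a v := by
  rw [sum_mul_lap]
  refine Finset.sum_nonneg fun e _ => ?_
  have := Γ.len_pos e
  have := mul_self_nonneg (a (Γ.src e) - a (Γ.tgt e))
  positivity

theorem lap_linear (a b : V → ℝ) (c d : ℝ) (v : V) :
    Γ.lap (fun u => c * a u + d * b u) v = c * Γ.lap a v + d * Γ.lap b v := by
  classical
  simp only [lap, Finset.mul_sum, ← Finset.sum_add_distrib]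
  refine Finset.sum_congr rfl fun e _ => ?_
  split_ifs <;> ring

/-- An edge affects the Laplacian only through the current it carries between its ends; this serves
both the parallel law and bridges. -/
theorem lap_eq_lap_deleteEdge_add [DecidableEq E] (e : E) (a : V → ℝ) (v : V) :
    Γ.lap a v = (Γ.deleteEdge e).lap a v + (a (Γ.src e) - a (Γ.tgt e)) / Γ.len e *
      open scoped Classical in
      ((if Γ.src e = v then 1 else 0) - (if Γ.tgt e = v then 1 else 0)) := by
  classical
  have h := Finset.sum_subtype (F := inferInstance) (p := fun e' => e' ≠ e)
    (Finset.univ.erase e) (by simp) fun e' => ((if Γ.src e' = v then (a (Γ.src e') - a (Γ.tgt e')) / Γ.len e' else 0) +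
    (if Γ.tgt e' = v then (a (Γ.tgt e') - a (Γ.src e')) / Γ.len e' else 0))
  rw [lap, ← Finset.sum_erase_add _ _ (Finset.mem_univ e), h]
  congr 1
  · split_ifs <;> ring

/-- One factor n counts the parallel copies, the other comes from the conductance n / L of each
copy. -/
theorem lap_multiplyEdges (n : ℕ) (a : V → ℝ) (v : V) :
    (Γ.multiplyEdges n).lap a v = n ^ 2 * Γ.lap a v := by
  classical
  rw [lap, lap, Fintype.sum_prod_type, Finset.mul_sum]
  refine Finset.sum_congr rfl fun e _ => ?_
  simp only [MetrizedGraph.multiplyEdges, Finset.sum_const, Finset.card_univ, Fintype.card_fin,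
    nsmul_eq_mul, div_div_eq_mul_div]
  split_ifs <;> ring

variable {Γ}

/-- The Dirichlet energy of a harmonic function is 0, so each edge term vanishes and no edge sees a
difference. -/
theorem Connected.eq_of_lap_eq_zero [Fintype V] (hΓ : Γ.Connected) {a : V → ℝ} (ha : ∀ v, Γ.lap a v = 0)
    (u v : V) : a u = a v := by
  refine hΓ.eq (fun e => ?_) u v
  have h := Γ.sum_mul_lap a a
  simp only [ha, mul_zero, Finset.sum_const_zero] at h
  have h0 := (Finset.sum_eq_zero_iff_of_nonneg fun e _ => ?_).1 h.symm e (Finset.mem_univ e)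
  · have := (Γ.len_pos e).ne'
    rw [div_eq_zero_iff, mul_self_eq_zero] at h0
    exact sub_eq_zero.1 (h0.resolve_right this)
  · have := Γ.len_pos e
    have := mul_self_nonneg (a (Γ.src e) - a (Γ.tgt e))
    positivity

variable (Γ) in
/-- A symmetric Green function of the Laplacian on vertices, for the uniform background charge. -/
structure IsGreen [Fintype V] (g : V → V → ℝ) : Prop where
  symm : ∀ u v, g u v = g v u
  lap_eq : ∀ u v, Γ.lap (g u) v =
    (open scoped Classical in if u = v then 1 else 0) - 1 / Fintype.card V

/-- Adding the total sum to the Laplacian makes it injective: a kernel element has sum 0, because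
Laplacians sum to 0, so it is harmonic, hence constant, hence 0. The preimages of the unit vectors
all have sum 1 / |V|, which produces the uniform background and, with self-adjointness, the
symmetry. -/
theorem Connected.exists_isGreen [Fintype V] (hΓ : Γ.Connected) : ∃ g, Γ.IsGreen g := by
  classical
  have hcard : (Fintype.card V : ℝ) ≠ 0 := by
    have := hΓ.nonempty
    exact_mod_cast Fintype.card_ne_zero
  let T : (V → ℝ) →ₗ[ℝ] (V → ℝ) :=
    { toFun := fun a v => Γ.lap a v + ∑ u, a u
      map_add' := fun a b => by
        ext v
        have := Γ.lap_linear a b 1 1 v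
        simp only [one_mul] at this
        simp only [Pi.add_apply, Finset.sum_add_distrib]
        change Γ.lap (fun u => a u + b u) v + _ = _
        rw [this]
        ring
      map_smul' := fun c a => by
        ext v
        have := Γ.lap_linear a 0 c 0 v
        simp only [zero_mul, add_zero] at this
        simp only [Pi.smul_apply, smul_eq_mul, RingHom.id_apply, mul_add, Finset.mul_sum]
        rw [← this]
        rfl }
  have hT : ∀ a v, T a v = Γ.lap a v + ∑ u, a u := fun _ _ => rfl
  have hsum : ∀ a, ∑ v, T a v = Fintype.card V * ∑ u, a u := fun a => by
    simp only [hT, Finset.sum_add_distrib, Γ.sum_lap, zero_add, Finset.sum_const, nsmul_eq_mul,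
      Finset.card_univ]
  have hinj : Function.Injective T := by
    rw [← LinearMap.ker_eq_bot, LinearMap.ker_eq_bot']
    intro a ha
    have h0 : ∑ u, a u = 0 := by
      have := hsum a
      rw [ha] at this
      simpa [hcard] using this
    have h1 : ∀ v, Γ.lap a v = 0 := fun v => by
      have := hT a v
      rw [ha, h0] at this
      simpa using this.symm
    ext v
    have h2 : ∑ u, a u = ∑ _u : V, a v :=
      Finset.sum_congr rfl fun u _ => hΓ.eq_of_lap_eq_zero h1 u v
    rw [h0, Finset.sum_const, Finset.card_univ, nsmul_eq_mul] at h2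
    simpa [hcard] using h2.symm
  have hsurj := LinearMap.surjective_of_injective hinj
  choose g hg using fun u : V => hsurj (Pi.single u 1)
  have hgs : ∀ u, ∑ v, g u v = 1 / Fintype.card V := fun u => by
    have := hsum (g u)
    rw [hg, Finset.sum_pi_single'] at this
    simp only [Finset.mem_univ, if_true] at this
    rw [this]
    field_simp
  have hlap : ∀ u v, Γ.lap (g u) v = (if u = v then 1 else 0) - 1 / Fintype.card V := fun u v => by
    have := hT (g u) v
    rw [hg, hgs, Pi.single_apply] at this
    simp only [eq_comm (a := u)]
    rw [this]
    ring
  refine ⟨g, fun u v => ?_, fun u v => by rw [hlap]⟩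
  have h := Γ.sum_mul_lap_comm (g u) (g v)
  simp only [hlap, mul_sub, mul_ite, mul_one, mul_zero, Finset.sum_sub_distrib,
    Finset.sum_ite_eq, Finset.mem_univ, if_true, ← Finset.sum_mul, hgs] at h
  linarith

/-- The effective resistance between two vertices, in terms of a Green function. -/
def vertexResistance (g : V → V → ℝ) (u v : V) : ℝ := g u u - 2 * g u v + g v v

variable [Fintype V] {g : V → V → ℝ}

/-- A unit current flow computes the effective resistance. -/
theorem IsGreen.sub_eq (hg : Γ.IsGreen g) {a : V → ℝ} {x y : V} {c : ℝ}
    (ha : open scoped Classical in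
      ∀ v, Γ.lap a v = c * ((if x = v then 1 else 0) - (if y = v then 1 else 0))) :
    a x - a y = c * vertexResistance g x y := by
  classical
  -- Pairing with `g x` recovers a at x up to the mean of a; the mean drops out of the difference
  -- between x and y.
  have h1 := Γ.sum_mul_lap_comm a (g x)
  have h2 := Γ.sum_mul_lap_comm a (g y)
  simp only [ha, hg.lap_eq, mul_sub, mul_ite, mul_one, mul_zero, Finset.sum_sub_distrib,
    Finset.sum_ite_eq, Finset.mem_univ, if_true] at h1 h2
  have := hg.symm x y
  unfold vertexResistance
  linear_combination h2 - h1 + c * this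

/-- The potential of a unit current flow. -/
theorem IsGreen.lap_sub (hg : Γ.IsGreen g) (x y v : V) :
    Γ.lap (fun v => g x v - g y v) v =
      open scoped Classical in (if x = v then 1 else 0) - (if y = v then 1 else 0) := by
  have := Γ.lap_linear (g x) (g y) 1 (-1) v
  simp only [one_mul, neg_mul, ← sub_eq_add_neg, hg.lap_eq] at this
  rw [this]
  ring

/-- The Laplacian of the diagonal of a Green function. -/
theorem IsGreen.lap_diag (hg : Γ.IsGreen g) (v : V) :
    Γ.lap (fun u => g u u) v = 2 * (1 - 1 / Fintype.card V) -
      open scoped Classical in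
      ∑ e, ((if Γ.src e = v then vertexResistance g (Γ.src e) (Γ.tgt e) / Γ.len e else 0) +
        (if Γ.tgt e = v then vertexResistance g (Γ.src e) (Γ.tgt e) / Γ.len e else 0)) := by
  classical
  -- Compare with twice the Laplacian of `g v` at v, edge by edge: if w is the other end, g v v − g
  -- w w = 2(g v v − g v w) − r(v,w).
  have h := hg.lap_eq v v
  rw [if_pos rfl] at h
  rw [← h, lap, lap, Finset.mul_sum, ← Finset.sum_sub_distrib]
  refine Finset.sum_congr rfl fun e _ => ?_
  have h1 := hg.symm (Γ.src e) (Γ.tgt e)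
  unfold vertexResistance
  split_ifs with h2 h3 h3
  · rw [h2, h3]
    ring
  · rw [← h2]
    ring
  · rw [← h3, h1]
    ring
  · ring

/-- **Foster's theorem**. -/
theorem IsGreen.sum_vertexResistance_div_len (hg : Γ.IsGreen g) [Nonempty V] :
    ∑ e, vertexResistance g (Γ.src e) (Γ.tgt e) / Γ.len e = Fintype.card V - 1 := by
  classical
  -- The Laplacian of the diagonal has total 0, and each edge enters it once from each end.
  have h := Γ.sum_lap fun u => g u u
  simp only [hg.lap_diag, Finset.sum_sub_distrib, Finset.sum_const, Finset.card_univ,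
    nsmul_eq_mul] at h
  rw [Finset.sum_comm] at h
  simp only [Finset.sum_add_distrib, Finset.sum_ite_eq, Finset.mem_univ, if_true] at h
  have hcard : (Fintype.card V : ℝ) ≠ 0 := by exact_mod_cast Fintype.card_ne_zero
  field_simp at h
  linarith

/-- The resistance is the Dirichlet energy of the potential of a unit current from x to y. -/
theorem IsGreen.vertexResistance_nonneg (hg : Γ.IsGreen g) (x y : V) :
    0 ≤ vertexResistance g x y := by
  classical
  have h : g x x - g y x - (g x y - g y y) = vertexResistance g x y := by
    unfold vertexResistance
    linear_combination hg.symm x y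
  have h2 := Γ.sum_mul_lap_self_nonneg fun v => g x v - g y v
  simp only [hg.lap_sub, mul_sub, mul_ite, mul_one, mul_zero, Finset.sum_sub_distrib,
    Finset.sum_ite_eq, Finset.mem_univ, if_true] at h2
  rwa [← h]

/-! ### Deleting an edge: the parallel law and bridges -/

section DeleteEdge

variable [DecidableEq E] {e : E}

/-- Resistances in parallel. -/
theorem IsGreen.vertexResistance_deleteEdge (hg : Γ.IsGreen g) {g' : V → V → ℝ}
    (hg' : (Γ.deleteEdge e).IsGreen g') :
    Γ.len e * vertexResistance g' (Γ.src e) (Γ.tgt e) =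
      (Γ.len e + vertexResistance g' (Γ.src e) (Γ.tgt e)) *
        vertexResistance g (Γ.src e) (Γ.tgt e) := by
  classical
  have h2 : g' (Γ.src e) (Γ.src e) - g' (Γ.tgt e) (Γ.src e) -
      (g' (Γ.src e) (Γ.tgt e) - g' (Γ.tgt e) (Γ.tgt e)) =
      vertexResistance g' (Γ.src e) (Γ.tgt e) := by
    unfold vertexResistance
    linear_combination hg'.symm (Γ.src e) (Γ.tgt e)
  -- The potential of a unit current in Γ − e has drop R across e. Viewed in Γ it also drives a
  -- current R / L through e, so the total current is 1 + R / L.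
  have h3 : ∀ v, Γ.lap (fun v => g' (Γ.src e) v - g' (Γ.tgt e) v) v =
      (1 + vertexResistance g' (Γ.src e) (Γ.tgt e) / Γ.len e) *
      ((if Γ.src e = v then 1 else 0) - (if Γ.tgt e = v then 1 else 0)) := fun v => by
    rw [Γ.lap_eq_lap_deleteEdge_add e, hg'.lap_sub, h2]
    ring
  have h4 := hg.sub_eq h3
  rw [h2] at h4
  have := (Γ.len_pos e).ne'
  field_simp at h4
  linarith

/-- The resistance along a bridge is its length. -/
theorem IsGreen.vertexResistance_of_not_connected (hg : Γ.IsGreen g) (hΓ : Γ.Connected)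
    (h : ¬(Γ.deleteEdge e).Connected) :
    vertexResistance g (Γ.src e) (Γ.tgt e) = Γ.len e := by
  classical
  have hnr := hΓ.not_reachable_of_not_connected_deleteEdge h
  set G := SimpleGraph.fromRel fun u v => ∃ e', (Γ.deleteEdge e).src e' = u ∧
      (Γ.deleteEdge e).tgt e' = v with hG
  -- A unit current through the bridge: constant on each side, with drop L across e.
  let a : V → ℝ := fun w => if G.Reachable (Γ.src e) w then Γ.len e else 0
  have ha1 : a (Γ.src e) = Γ.len e := if_pos (SimpleGraph.Reachable.refl _)
  have ha2 : a (Γ.tgt e) = 0 := if_neg hnr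
  have hL := (Γ.len_pos e).ne'
  have ha : ∀ v, Γ.lap a v =
      1 * ((if Γ.src e = v then 1 else 0) - (if Γ.tgt e = v then 1 else 0)) := fun v => by
    rw [Γ.lap_eq_lap_deleteEdge_add e, ha1, ha2, sub_zero, div_self hL, add_eq_right]
    refine Finset.sum_eq_zero fun e' _ => ?_
    have : a ((Γ.deleteEdge e).src e') = a ((Γ.deleteEdge e).tgt e') := by
      have hr := (Γ.deleteEdge e).reachable_src_tgt e'
      have : G.Reachable (Γ.src e) ((Γ.deleteEdge e).src e') ↔
        G.Reachable (Γ.src e) ((Γ.deleteEdge e).tgt e') :=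
        ⟨fun h => h.trans hr, fun h => h.trans hr.symm⟩
      simp only [a, this]
    simp [this]
  have := hg.sub_eq ha
  rw [ha1, ha2] at this
  linarith

end DeleteEdge

theorem IsGreen.multiplyEdges (hg : Γ.IsGreen g) {n : ℕ} (hn : n ≠ 0) :
    (Γ.multiplyEdges n).IsGreen fun u v => g u v / n ^ 2 where
  symm u v := by rw [hg.symm]
  lap_eq u v := by
    have h := Γ.lap_linear (g u) 0 (1 / n ^ 2 : ℝ) 0 v
    simp only [zero_mul, add_zero] at h
    have hn' : (n : ℝ) ≠ 0 := by exact_mod_cast hn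
    rw [lap_multiplyEdges, ← hg.lap_eq]
    simp only [div_eq_inv_mul _ ((n : ℝ) ^ 2)]
    simp only [one_div] at h
    rw [h]
    field_simp

end Discrete

end MetrizedGraph

/-! ### Piecewise affine functions of a real variable -/

/-- A function that is locally affine on an open interval and continuous up to its end points is
affine. -/
theorem exists_affine_of_locally_affine {φ : ℝ → ℝ} (hφ : Continuous φ) {a b : ℝ}
    (h : ∀ t ∈ Ioo a b, ∃ m c : ℝ, ∀ᶠ s in 𝓝 t, φ s = m * s + c) :
    ∃ m, ∀ s ∈ Icc a b, φ s = φ a + m * (s - a) := by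
  rcases le_or_gt b a with hab | hab
  · refine ⟨0, fun s hs => ?_⟩
    rw [le_antisymm (hs.2.trans hab) hs.1]
    ring
  have hder : ∀ t m c : ℝ, (∀ᶠ s in 𝓝 t, φ s = m * s + c) → HasDerivAt φ m t := fun t m c hs => by
    have : HasDerivAt (fun s => m * s + c) m t := by
      simpa using ((hasDerivAt_id t).const_mul m).add_const c
    exact this.congr_of_eventuallyEq hs
  have hloc : ∀ t ∈ Ioo a b, ∀ᶠ s in 𝓝 t, deriv φ s = deriv φ t := fun t ht => by
    obtain ⟨m, c, hs⟩ := h t ht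
    filter_upwards [hs.eventually_nhds] with s hs'
    rw [(hder t m c hs).deriv, (hder s m c hs').deriv]
  have hdiff : ∀ t ∈ Ioo a b, HasDerivAt φ (deriv φ t) t := fun t ht => by
    obtain ⟨m, c, hs⟩ := h t ht
    exact (hder t m c hs).differentiableAt.hasDerivAt
  -- The derivative is locally constant, hence constant on the connected interval.
  obtain ⟨m, hm⟩ : ∃ m, ∀ t ∈ Ioo a b, deriv φ t = m := by
    refine ⟨deriv φ ((a + b) / 2), fun t ht => ?_⟩
    have hd : ∀ s ∈ Ioo a b, HasDerivAt (deriv φ) 0 s := fun s hs =>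
      (hasDerivAt_const s (deriv φ s)).congr_of_eventuallyEq (hloc s hs)
    exact isOpen_Ioo.is_const_of_deriv_eq_zero isPreconnected_Ioo
      (fun s hs => (hd s hs).differentiableAt.differentiableWithinAt)
      (fun s hs => (hd s hs).deriv) ht ⟨by linarith, by linarith⟩
  refine ⟨m, fun s hs => ?_⟩
  have hc : ContinuousOn (fun s => φ s - m * s) (Icc a b) := by fun_prop
  have h0 : ∀ t ∈ Ioo a b, HasDerivAt (fun s => φ s - m * s) 0 t := fun t ht => by
    have := (hdiff t ht).fun_sub ((hasDerivAt_id t).const_mul m)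
    simpa [hm t ht] using this
  rcases hs.1.eq_or_lt with rfl | has
  · ring
  -- The mean value theorem needs only continuity at the end points, where nothing is known about
  -- derivatives.
  obtain ⟨c, hc1, hc2⟩ := exists_hasDerivAt_eq_slope (fun s => φ s - m * s) (fun _ => 0) has
    (hc.mono (Icc_subset_Icc_right hs.2)) fun t ht => h0 t ⟨ht.1, ht.2.trans_le hs.2⟩
  have hne : s - a ≠ 0 := (sub_pos.2 has).ne'
  field_simp at hc2
  linarith

/-- The break points are finite in number, so some interval immediately to the right of t contains
none, even if t is one itself. -/
theorem exists_affine_right {φ : ℝ → ℝ} (hφ : Continuous φ) {S : Set ℝ} (hS : S.Finite) {L : ℝ}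
    (h : ∀ t ∈ Ioo 0 L, t ∉ S → ∃ m c : ℝ, ∀ᶠ s in 𝓝 t, φ s = m * s + c) {t : ℝ}
    (ht : t ∈ Ico 0 L) : ∃ m, ∀ᶠ s in 𝓝[≥] t, φ s = φ t + m * (s - t) := by
  have h1 : ∀ᶠ s in 𝓝[>] t, s ∉ S := by
    have : (S \ {t})ᶜ ∈ 𝓝 t := (hS.sdiff).isClosed.isOpen_compl.mem_nhds (by simp)
    filter_upwards [mem_nhdsWithin_of_mem_nhds this, self_mem_nhdsWithin] with s hs hs'
    exact fun h => hs ⟨h, hs'.ne'⟩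
  have h2 : ∀ᶠ s in 𝓝[>] t, s < L := mem_nhdsWithin_of_mem_nhds (Iio_mem_nhds ht.2)
  obtain ⟨u, hu, hu'⟩ := mem_nhdsGT_iff_exists_Ioo_subset.1 (h1.and h2)
  obtain ⟨m, hm⟩ := exists_affine_of_locally_affine hφ (a := t) (b := u) fun s hs =>
    h s ⟨ht.1.trans_lt hs.1, (hu' hs).2⟩ (hu' hs).1
  exact ⟨m, Filter.mem_of_superset (Icc_mem_nhdsGE hu) hm⟩

theorem exists_affine_left {φ : ℝ → ℝ} (hφ : Continuous φ) {S : Set ℝ} (hS : S.Finite) {L : ℝ}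
    (h : ∀ t ∈ Ioo 0 L, t ∉ S → ∃ m c : ℝ, ∀ᶠ s in 𝓝 t, φ s = m * s + c) {t : ℝ}
    (ht : t ∈ Ioc 0 L) : ∃ m, ∀ᶠ s in 𝓝[≤] t, φ s = φ t + m * (s - t) := by
  have h1 : ∀ᶠ s in 𝓝[<] t, s ∉ S := by
    have : (S \ {t})ᶜ ∈ 𝓝 t := (hS.sdiff).isClosed.isOpen_compl.mem_nhds (by simp)
    filter_upwards [mem_nhdsWithin_of_mem_nhds this, self_mem_nhdsWithin] with s hs hs'
    exact fun h => hs ⟨h, hs'.ne⟩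
  have h2 : ∀ᶠ s in 𝓝[<] t, 0 < s := mem_nhdsWithin_of_mem_nhds (Ioi_mem_nhds ht.1)
  obtain ⟨u, hu, hu'⟩ := mem_nhdsLT_iff_exists_Ioo_subset.1 (h1.and h2)
  obtain ⟨m, hm⟩ := exists_affine_of_locally_affine hφ (a := u) (b := t) fun s hs =>
    h s ⟨(hu' hs).2, hs.2.trans_le ht.2⟩ (hu' hs).1
  refine ⟨m, Filter.mem_of_superset (Icc_mem_nhdsLE hu) fun s hs => ?_⟩
  have := hm t ⟨hu.le, le_rfl⟩
  change φ s = _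
  rw [hm s hs, this]
  ring

theorem hasDerivWithinAt_of_eventually_affine {φ : ℝ → ℝ} {T : Set ℝ} {t m : ℝ}
    (h : ∀ᶠ s in 𝓝[T] t, φ s = φ t + m * (s - t)) : HasDerivWithinAt φ m T t := by
  have : HasDerivWithinAt (fun s => φ t + m * (s - t)) m T t := by
    simpa using (((hasDerivWithinAt_id t T).sub_const t).const_mul m).const_add (φ t)
  exact this.congr_of_eventuallyEq h (by ring)

/-- A continuous piecewise affine function without break points is affine. -/
theorem eq_affine_of_derivWithin_eq {φ : ℝ → ℝ} (hφ : Continuous φ) {S : Set ℝ} (hS : S.Finite)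
    {L : ℝ} (h : ∀ t ∈ Ioo 0 L, t ∉ S → ∃ m c : ℝ, ∀ᶠ s in 𝓝 t, φ s = m * s + c)
    (hd : ∀ t ∈ Ioo 0 L, derivWithin φ (Ici t) t = derivWithin φ (Iic t) t) :
    ∃ m, ∀ s ∈ Icc 0 L, φ s = φ 0 + m * s := by
  simpa using exists_affine_of_locally_affine hφ (a := 0) (b := L) fun t ht => by
    obtain ⟨m, hm⟩ := exists_affine_right hφ hS h (Ioo_subset_Ico_self ht)
    obtain ⟨m', hm'⟩ := exists_affine_left hφ hS h (Ioo_subset_Ioc_self ht)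
    have := hd t ht
    rw [(hasDerivWithinAt_of_eventually_affine hm).derivWithin (uniqueDiffWithinAt_Ici t),
      (hasDerivWithinAt_of_eventually_affine hm').derivWithin (uniqueDiffWithinAt_Iic t)] at this
    subst this
    refine ⟨m, φ t - m * t, ?_⟩
    rw [← nhdsLE_sup_nhdsGE, Filter.eventually_sup]
    exact ⟨hm'.mono fun s hs => by rw [hs]; ring, hm.mono fun s hs => by rw [hs]; ring⟩

/-! ### Continuous and piecewise affine functions on Γ, slopes, harmonic functions -/

namespace MetrizedGraph

variable {V E : Type*} (Γ : MetrizedGraph V E)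

theorem path_of_mem {e : E} {t : ℝ} (h : t ∈ Ioo 0 (Γ.len e)) :
    Γ.path e t = .interior e ⟨t, h⟩ := dif_pos h

theorem path_of_nonpos {e : E} {t : ℝ} (h : t ≤ 0) : Γ.path e t = .vertex (Γ.src e) := by
  rw [path, dif_neg fun h' => h'.1.not_ge h, if_pos h]

theorem path_of_len_le {e : E} {t : ℝ} (h : Γ.len e ≤ t) : Γ.path e t = .vertex (Γ.tgt e) := by
  rw [path, dif_neg fun h' => h'.2.not_ge h, if_neg ((Γ.len_pos e).trans_le h).not_ge]

theorem path_zero (e : E) : Γ.path e 0 = .vertex (Γ.src e) := Γ.path_of_nonpos le_rfl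

theorem path_len (e : E) : Γ.path e (Γ.len e) = .vertex (Γ.tgt e) := Γ.path_of_len_le le_rfl

theorem path_coe (e : E) (t : Ioo 0 (Γ.len e)) : Γ.path e t = .interior e t := Γ.path_of_mem t.2

theorem path_clamp (e : E) (t : ℝ) : Γ.path e (max 0 (min t (Γ.len e))) = Γ.path e t := by
  have := Γ.len_pos e
  rcases le_or_gt t 0 with h | h
  · rw [min_eq_left (h.trans this.le), max_eq_left h, path_zero, path_of_nonpos _ h]
  · rcases le_or_gt (Γ.len e) t with h' | h'
    · rw [min_eq_right h', max_eq_right this.le, path_len, path_of_len_le _ h']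
    · rw [min_eq_left h'.le, max_eq_right h.le]

variable {Γ}

theorem continuous_iff {X : Type*} [TopologicalSpace X] {f : Γ.Point → X} :
    Continuous f ↔ ∀ e, Continuous fun t => f (Γ.path e t) := by
  rw [continuous_iSup_dom]
  exact forall_congr' fun e => continuous_coinduced_dom

theorem continuous_path (e : E) : Continuous (Γ.path e) := continuous_iff.1 continuous_id e

/-- Edge formulas hold on [0, L] only, while the topology tests the parametrization on all of ℝ;
clamping the parameter reconciles the two. -/
theorem continuous_of_eqOn_path {f : Γ.Point → ℝ} {F : E → ℝ → ℝ} (hF : ∀ e, Continuous (F e))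
    (h : ∀ e, ∀ t ∈ Icc 0 (Γ.len e), f (Γ.path e t) = F e t) : Continuous f := by
  refine continuous_iff.2 fun e => ?_
  have : (fun t => f (Γ.path e t)) = fun t => F e (max 0 (min t (Γ.len e))) := by
    ext t
    rw [← h, path_clamp]
    exact ⟨le_max_left _ _, max_le (Γ.len_pos e).le (min_le_right _ _)⟩
  rw [this]
  have := hF e
  fun_prop

namespace IsPiecewiseAffine

variable {f f' : Γ.Point → ℝ}

theorem add (hf : Γ.IsPiecewiseAffine f) (hf' : Γ.IsPiecewiseAffine f') :
    Γ.IsPiecewiseAffine fun x => f x + f' x := by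
  obtain ⟨hc, S, hS, h⟩ := hf
  obtain ⟨hc', S', hS', h'⟩ := hf'
  refine ⟨hc.add hc', S ∪ S', hS.union hS', fun e t ht hts => ?_⟩
  obtain ⟨a, b, hab⟩ := h e t ht fun h => hts (Or.inl h)
  obtain ⟨a', b', hab'⟩ := h' e t ht fun h => hts (Or.inr h)
  refine ⟨a + a', b + b', ?_⟩
  filter_upwards [hab, hab'] with s hs hs'
  rw [hs, hs']
  ring

theorem const_mul (hf : Γ.IsPiecewiseAffine f) (c : ℝ) :
    Γ.IsPiecewiseAffine fun x => c * f x := by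
  obtain ⟨hc, S, hS, h⟩ := hf
  refine ⟨hc.const_mul c, S, hS, fun e t ht hts => ?_⟩
  obtain ⟨a, b, hab⟩ := h e t ht hts
  refine ⟨c * a, c * b, ?_⟩
  filter_upwards [hab] with s hs
  rw [hs]
  ring

variable (Γ) in
theorem const (c : ℝ) : Γ.IsPiecewiseAffine fun _ => c :=
  ⟨continuous_const, ∅, finite_empty, fun _ _ _ _ => ⟨0, c, by simp⟩⟩

theorem of_eqOn_path {F : E → ℝ → ℝ} (hF : ∀ e, Continuous (F e))
    (h : ∀ e, ∀ t ∈ Icc 0 (Γ.len e), f (Γ.path e t) = F e t) {S : Set Γ.Point} (hS : S.Finite)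
    (haff : ∀ e, ∀ t ∈ Ioo 0 (Γ.len e), Γ.path e t ∉ S → ∃ a b, ∀ᶠ s in 𝓝 t, F e s = a * s + b) :
    Γ.IsPiecewiseAffine f := by
  refine ⟨continuous_of_eqOn_path hF h, S, hS, fun e t ht hts => ?_⟩
  obtain ⟨a, b, hab⟩ := haff e t ht hts
  refine ⟨a, b, ?_⟩
  filter_upwards [hab, isOpen_Ioo.mem_nhds ht] with s hs hs'
  rw [h e s (Ioo_subset_Icc_self hs'), hs]

/-- The parametrization is injective on the open edge, so a finite exceptional set in Γ has only
finitely many parameters there. -/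
theorem exists_finite (hf : Γ.IsPiecewiseAffine f) (e : E) : ∃ S : Set ℝ, S.Finite ∧
    ∀ t ∈ Ioo (0 : ℝ) (Γ.len e), t ∉ S → ∃ m c : ℝ, ∀ᶠ s in 𝓝 t, f (Γ.path e s) = m * s + c := by
  obtain ⟨-, S, hS, h⟩ := hf
  refine ⟨Γ.path e ⁻¹' S ∩ Ioo 0 (Γ.len e), ?_, fun t ht hts => h e t ht fun h' => hts ⟨h', ht⟩⟩
  refine Finite.of_finite_image (hS.subset (by rintro _ ⟨t, ht, rfl⟩; exact ht.1 : Γ.path e '' _ ⊆ S)) ?_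
  intro s hs t ht hst
  simp only [path_of_mem Γ hs.2, path_of_mem Γ ht.2, Point.interior.injEq, heq_eq_eq,
    Subtype.mk.injEq, true_and] at hst
  exact hst

end IsPiecewiseAffine

/-- The one-sided slopes of `f` along the edges, for increasing parameters, are `p` to the right and
`q` to the left. -/
structure HasSlopes (f : Γ.Point → ℝ) (p q : E → ℝ → ℝ) : Prop where
  right : ∀ e, ∀ t ∈ Ico 0 (Γ.len e), HasDerivWithinAt (fun s => f (Γ.path e s)) (p e t) (Ici t) t
  left : ∀ e, ∀ t ∈ Ioc 0 (Γ.len e), HasDerivWithinAt (fun s => f (Γ.path e s)) (q e t) (Iic t) t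

namespace HasSlopes

variable {f f' : Γ.Point → ℝ} {p q p' q' : E → ℝ → ℝ}

theorem add (hf : HasSlopes f p q) (hf' : HasSlopes f' p' q') :
    HasSlopes (fun x => f x + f' x) (fun e t => p e t + p' e t) (fun e t => q e t + q' e t) where
  right e t ht := (hf.right e t ht).fun_add (hf'.right e t ht)
  left e t ht := (hf.left e t ht).fun_add (hf'.left e t ht)

theorem const_mul (hf : HasSlopes f p q) (c : ℝ) :
    HasSlopes (fun x => c * f x) (fun e t => c * p e t) (fun e t => c * q e t) where
  right e t ht := (hf.right e t ht).const_mul c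
  left e t ht := (hf.left e t ht).const_mul c

theorem of_eqOn_path {F : E → ℝ → ℝ}
    (h : ∀ e, ∀ t ∈ Icc 0 (Γ.len e), f (Γ.path e t) = F e t)
    (hr : ∀ e, ∀ t ∈ Ico 0 (Γ.len e), HasDerivWithinAt (F e) (p e t) (Ici t) t)
    (hl : ∀ e, ∀ t ∈ Ioc 0 (Γ.len e), HasDerivWithinAt (F e) (q e t) (Iic t) t) :
    HasSlopes f p q where
  right e t ht := by
    refine (hr e t ht).congr_of_eventuallyEq ?_ (h e t (Ico_subset_Icc_self ht))
    filter_upwards [Icc_mem_nhdsGE ht.2] with s hs using h e s ⟨ht.1.trans hs.1, hs.2⟩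
  left e t ht := by
    refine (hl e t ht).congr_of_eventuallyEq ?_ (h e t (Ioc_subset_Icc_self ht))
    filter_upwards [Icc_mem_nhdsLE ht.1] with s hs using h e s ⟨hs.1, hs.2.trans ht.2⟩

theorem forwardDeriv_eq (hf : HasSlopes f p q) {e : E} {t : ℝ} (ht : t ∈ Ico 0 (Γ.len e)) :
    Γ.forwardDeriv f e t = p e t :=
  (hf.right e t ht).derivWithin (uniqueDiffWithinAt_Ici t)

theorem backwardDeriv_eq (hf : HasSlopes f p q) {e : E} {t : ℝ} (ht : t ∈ Ioc 0 (Γ.len e)) :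
    Γ.backwardDeriv f e t = -q e t := by
  rw [backwardDeriv, (hf.left e t ht).derivWithin (uniqueDiffWithinAt_Iic t)]

theorem slopeSum_interior [Fintype E] (hf : HasSlopes f p q) (e : E) (t : Ioo 0 (Γ.len e)) :
    Γ.slopeSum f (.interior e t) = p e t - q e t := by
  rw [slopeSum, hf.forwardDeriv_eq (Ioo_subset_Ico_self t.2),
    hf.backwardDeriv_eq (Ioo_subset_Ioc_self t.2), sub_eq_add_neg]

theorem slopeSum_vertex [Fintype E] (hf : HasSlopes f p q) (v : V) :
    Γ.slopeSum f (.vertex v) = open scoped Classical in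
      ∑ e : E, ((if Γ.src e = v then p e 0 else 0) - (if Γ.tgt e = v then q e (Γ.len e) else 0)) := by
  rw [slopeSum]
  refine Finset.sum_congr rfl fun e _ => ?_
  rw [hf.forwardDeriv_eq ⟨le_rfl, Γ.len_pos e⟩, hf.backwardDeriv_eq ⟨Γ.len_pos e, le_rfl⟩]
  split_ifs <;> ring

end HasSlopes

/-- `derivWithin` is additive only where one-sided derivatives exist; this supplies them, and thus
linearity of `slopeSum`. -/
theorem IsPiecewiseAffine.exists_hasSlopes {f : Γ.Point → ℝ} (hf : Γ.IsPiecewiseAffine f) :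
    ∃ p q, HasSlopes f p q := by
  have hr : ∀ e t, ∃ m, t ∈ Ico 0 (Γ.len e) →
      HasDerivWithinAt (fun s => f (Γ.path e s)) m (Ici t) t := fun e t => by
    by_cases ht : t ∈ Ico 0 (Γ.len e)
    · obtain ⟨S, hS, h⟩ := hf.exists_finite e
      obtain ⟨m, hm⟩ := exists_affine_right (continuous_iff.1 hf.1 e) hS h ht
      exact ⟨m, fun _ => hasDerivWithinAt_of_eventually_affine hm⟩
    · exact ⟨0, fun h => absurd h ht⟩
  have hl : ∀ e t, ∃ m, t ∈ Ioc 0 (Γ.len e) →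
      HasDerivWithinAt (fun s => f (Γ.path e s)) m (Iic t) t := fun e t => by
    by_cases ht : t ∈ Ioc 0 (Γ.len e)
    · obtain ⟨S, hS, h⟩ := hf.exists_finite e
      obtain ⟨m, hm⟩ := exists_affine_left (continuous_iff.1 hf.1 e) hS h ht
      exact ⟨m, fun _ => hasDerivWithinAt_of_eventually_affine hm⟩
    · exact ⟨0, fun h => absurd h ht⟩
  choose p hp using hr
  choose q hq using hl
  exact ⟨p, q, hp, hq⟩

section Linear

variable [Fintype E] {f f' : Γ.Point → ℝ}

theorem slopeSum_add (hf : Γ.IsPiecewiseAffine f) (hf' : Γ.IsPiecewiseAffine f') (x : Γ.Point) :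
    Γ.slopeSum (fun x => f x + f' x) x = Γ.slopeSum f x + Γ.slopeSum f' x := by
  classical
  obtain ⟨p, q, h⟩ := hf.exists_hasSlopes
  obtain ⟨p', q', h'⟩ := hf'.exists_hasSlopes
  cases x with
  | vertex v =>
    rw [h.slopeSum_vertex, h'.slopeSum_vertex, (h.add h').slopeSum_vertex,
      ← Finset.sum_add_distrib]
    refine Finset.sum_congr rfl fun e _ => ?_
    split_ifs <;> ring
  | interior e t =>
    rw [h.slopeSum_interior, h'.slopeSum_interior, (h.add h').slopeSum_interior]
    ring

theorem slopeSum_const_mul (hf : Γ.IsPiecewiseAffine f) (c : ℝ) (x : Γ.Point) :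
    Γ.slopeSum (fun x => c * f x) x = c * Γ.slopeSum f x := by
  classical
  obtain ⟨p, q, h⟩ := hf.exists_hasSlopes
  cases x with
  | vertex v =>
    rw [h.slopeSum_vertex, (h.const_mul c).slopeSum_vertex, Finset.mul_sum]
    refine Finset.sum_congr rfl fun e _ => ?_
    split_ifs <;> ring
  | interior e t =>
    rw [h.slopeSum_interior, (h.const_mul c).slopeSum_interior]
    ring

theorem slopeSum_const (c : ℝ) (x : Γ.Point) : Γ.slopeSum (fun _ => c) x = 0 := by
  have h : HasSlopes (Γ := Γ) (fun _ => c) 0 0 :=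
    ⟨fun _ t _ => hasDerivWithinAt_const t _ c, fun _ t _ => hasDerivWithinAt_const t _ c⟩
  cases x with
  | vertex v => simp [h.slopeSum_vertex]
  | interior e t => simp [h.slopeSum_interior]

end Linear

/-- The extension of a function on vertices that is affine on edges. -/
def interp (a : V → ℝ) : Γ.Point → ℝ
  | .vertex v => a v
  | .interior e t => (1 - t / Γ.len e) * a (Γ.src e) + t / Γ.len e * a (Γ.tgt e)

theorem interp_path (a : V → ℝ) (e : E) {t : ℝ} (ht : t ∈ Icc 0 (Γ.len e)) :
    interp a (Γ.path e t) = (1 - t / Γ.len e) * a (Γ.src e) + t / Γ.len e * a (Γ.tgt e) := by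
  have := (Γ.len_pos e).ne'
  rcases ht.1.eq_or_lt with rfl | h0
  · simp [path_zero, interp]
  rcases ht.2.eq_or_lt with rfl | h1
  · simp [path_len, interp, this]
  · rw [Γ.path_of_mem ⟨h0, h1⟩, interp]

theorem isPiecewiseAffine_interp (a : V → ℝ) : Γ.IsPiecewiseAffine (interp a) :=
  .of_eqOn_path (S := ∅) (fun e => by fun_prop) (fun e t => interp_path a e) finite_empty
    fun e t _ _ => ⟨(a (Γ.tgt e) - a (Γ.src e)) / Γ.len e, a (Γ.src e),
      Filter.Eventually.of_forall fun s => by ring⟩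

theorem hasSlopes_interp (a : V → ℝ) :
    HasSlopes (Γ := Γ) (interp a) (fun e _ => (a (Γ.tgt e) - a (Γ.src e)) / Γ.len e)
      (fun e _ => (a (Γ.tgt e) - a (Γ.src e)) / Γ.len e) :=
  .of_eqOn_path (fun e t => interp_path a e)
    (fun e t _ => hasDerivWithinAt_of_eventually_affine
      (Filter.Eventually.of_forall fun s => by ring))
    (fun e t _ => hasDerivWithinAt_of_eventually_affine
      (Filter.Eventually.of_forall fun s => by ring))

theorem slopeSum_interp_vertex [Fintype E] (a : V → ℝ) (v : V) :
    Γ.slopeSum (interp a) (.vertex v) = -Γ.lap a v := by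
  classical
  rw [(hasSlopes_interp a).slopeSum_vertex, lap, ← Finset.sum_neg_distrib]
  refine Finset.sum_congr rfl fun e _ => ?_
  split_ifs <;> ring

theorem slopeSum_interp_interior [Fintype E] (a : V → ℝ) (e : E) (t : Ioo 0 (Γ.len e)) :
    Γ.slopeSum (interp a) (.interior e t) = 0 := by
  rw [(hasSlopes_interp a).slopeSum_interior, sub_self]

/-- A piecewise affine function that is harmonic at all interior points of edges is affine on
edges. -/
theorem IsPiecewiseAffine.eq_interp [Fintype E] {f : Γ.Point → ℝ} (hf : Γ.IsPiecewiseAffine f)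
    (h : ∀ e t, Γ.slopeSum f (.interior e t) = 0) : f = interp fun v => f (.vertex v) := by
  have key : ∀ e, ∃ m, ∀ t ∈ Icc 0 (Γ.len e), f (Γ.path e t) = f (Γ.path e 0) + m * t :=
    fun e => by
      obtain ⟨S, hS, h'⟩ := hf.exists_finite e
      -- A vanishing slope sum at an interior point says that the right and left derivatives agree.
      refine eq_affine_of_derivWithin_eq (continuous_iff.1 hf.1 e) hS h' fun t ht => ?_
      have := h e ⟨t, ht⟩
      rw [slopeSum, forwardDeriv, backwardDeriv] at this
      linarith
  ext x
  cases x with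
  | vertex v => rfl
  | interior e t =>
    obtain ⟨m, hm⟩ := key e
    have hL := Γ.len_pos e
    have h1 := hm (Γ.len e) ⟨hL.le, le_rfl⟩
    rw [path_len, path_zero] at h1
    rw [interp, h1, ← path_coe, hm t (Ioo_subset_Icc_self t.2), path_zero]
    field_simp
    ring

/-- Harmonicity inside edges makes f the interpolation of its vertex values, and harmonicity at
vertices then makes those values constant. Uniqueness of voltages follows. -/
theorem Connected.eq_of_slopeSum_eq_zero [Fintype V] [Fintype E] (hΓ : Γ.Connected)
    {f : Γ.Point → ℝ} (hf : Γ.IsPiecewiseAffine f) (h : ∀ x, Γ.slopeSum f x = 0)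
    (x y : Γ.Point) : f x = f y := by
  have hi := hf.eq_interp fun e t => h _
  set a : V → ℝ := fun v => f (.vertex v)
  have ha : ∀ v, Γ.lap a v = 0 := fun v => by
    have := h (.vertex v)
    rw [hi, slopeSum_interp_vertex] at this
    linarith
  have hc := hΓ.eq_of_lap_eq_zero ha
  have : ∀ x v, f x = a v := fun x v => by
    rw [hi]
    cases x with
    | vertex w => exact hc w v
    | interior e t =>
      rw [interp, hc (Γ.src e) v, hc (Γ.tgt e) v]
      ring
  obtain ⟨v⟩ := hΓ.nonempty
  rw [this x v, this y v]

end MetrizedGraph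

/-! ### The Green function of Γ, voltages and resistances -/

namespace MetrizedGraph

variable {V E : Type*} {Γ : MetrizedGraph V E}

/-- The Green function of the edges with Dirichlet conditions at the vertices. -/
def bump : Γ.Point → Γ.Point → ℝ
  | .interior e t, .interior e' s =>
    open scoped Classical in if e = e' then min (t : ℝ) s - t * s / Γ.len e else 0
  | _, _ => 0

theorem bump_comm (x y : Γ.Point) : bump x y = bump y x := by
  cases x <;> cases y <;> simp only [bump]
  case interior.interior e t e' s =>
    by_cases h : e = e'
    · subst h
      rw [if_pos rfl, if_pos rfl, min_comm, mul_comm (t : ℝ)]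
    · rw [if_neg h, if_neg (Ne.symm h)]

theorem bump_vertex (x : Γ.Point) (v : V) : bump x (.vertex v) = 0 := by
  cases x <;> rfl

theorem bump_path_interior {e : E} {t : ℝ} (ht : t ∈ Icc 0 (Γ.len e)) (e' : E)
    (s : Ioo 0 (Γ.len e')) : bump (Γ.path e t) (.interior e' s) =
      open scoped Classical in if e = e' then min t s - t * s / Γ.len e else 0 := by
  have hL := (Γ.len_pos e).ne'
  by_cases he : e = e'
  · subst he
    rw [if_pos rfl]
    rcases ht.1.eq_or_lt with rfl | h0
    · simp [path_zero, bump, s.2.1.le]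
    rcases ht.2.eq_or_lt with rfl | h1
    · rw [path_len, bump_comm, bump_vertex, min_eq_right s.2.2.le]
      field_simp
      ring
    · rw [Γ.path_of_mem ⟨h0, h1⟩, bump, if_pos rfl]
  · rw [if_neg he]
    rcases ht.1.eq_or_lt with rfl | h0
    · simp [path_zero, bump]
    rcases ht.2.eq_or_lt with rfl | h1
    · rw [path_len, bump_comm, bump_vertex]
    · rw [Γ.path_of_mem ⟨h0, h1⟩, bump, if_neg he]

theorem bump_path_path {e : E} {t s : ℝ} (ht : t ∈ Icc 0 (Γ.len e)) (hs : s ∈ Icc 0 (Γ.len e)) :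
    bump (Γ.path e t) (Γ.path e s) = min t s - t * s / Γ.len e := by
  have hL := (Γ.len_pos e).ne'
  rcases hs.1.eq_or_lt with rfl | h0
  · simp [path_zero, bump_vertex, ht.1]
  rcases hs.2.eq_or_lt with rfl | h1
  · rw [path_len, bump_vertex, min_eq_left ht.2]
    field_simp
    ring
  · rw [Γ.path_of_mem ⟨h0, h1⟩, bump_path_interior ht, if_pos rfl]

theorem bump_nonneg (x y : Γ.Point) : 0 ≤ bump x y := by
  cases x <;> cases y <;> simp only [bump, le_refl]
  case interior.interior e t e' s =>
    split_ifs with h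
    · subst h
      have hL := Γ.len_pos e
      rw [sub_nonneg, div_le_iff₀ hL]
      rcases le_total (t : ℝ) s with h | h
      · rw [min_eq_left h]
        exact mul_le_mul_of_nonneg_left s.2.2.le t.2.1.le
      · rw [min_eq_right h, mul_comm]
        exact mul_le_mul_of_nonneg_left t.2.2.le s.2.1.le
    · exact le_rfl

theorem bump_le [Fintype E] (x y : Γ.Point) : bump x y ≤ Γ.totalLength := by
  have h0 : 0 ≤ Γ.totalLength := Finset.sum_nonneg fun e _ => (Γ.len_pos e).le
  cases x <;> cases y <;> simp only [bump, h0]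
  case interior.interior e t e' s =>
    split_ifs with h
    · have hL := Γ.len_pos e
      have h1 : Γ.len e ≤ Γ.totalLength :=
        Finset.single_le_sum (f := Γ.len) (fun e _ => (Γ.len_pos e).le) (Finset.mem_univ e)
      have h2 : 0 ≤ (t : ℝ) * s / Γ.len e := by
        have := t.2.1
        have := s.2.1
        positivity
      have h3 := min_le_left (t : ℝ) s
      have h4 := t.2.2
      linarith
    · exact h0

theorem isPiecewiseAffine_bump (y : Γ.Point) : Γ.IsPiecewiseAffine fun x => bump x y := by
  classical
  cases y with
  | vertex v =>
    simp only [bump_vertex]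
    exact .const Γ 0
  | interior e' s =>
    refine .of_eqOn_path (S := {.interior e' s})
      (F := fun e t => if e = e' then min t s - t * s / Γ.len e else 0)
      (fun e => ?_) (fun e t ht => bump_path_interior ht e' s) (finite_singleton _)
      fun e t ht hts => ?_
    · by_cases h : e = e' <;> simp only [h, if_true, if_false] <;> fun_prop
    · by_cases h : e = e'
      · subst h
        have hne : t ≠ s := fun h => hts <| by
          subst h
          rw [path_coe, mem_singleton_iff]
        simp only [if_true]
        rcases hne.lt_or_gt with h | h
        · refine ⟨1 - s / Γ.len e, 0, ?_⟩
          filter_upwards [Iio_mem_nhds h] with u hu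
          rw [min_eq_left (le_of_lt hu)]
          ring
        · refine ⟨-s / Γ.len e, s, ?_⟩
          filter_upwards [Ioi_mem_nhds h] with u hu
          rw [min_eq_right (le_of_lt hu)]
          ring
      · exact ⟨0, 0, by simp [h]⟩

/-- The right and left slopes differ only at t = s, where strict versus weak inequality records the
drop by 1, i.e. the unit point mass. -/
theorem hasSlopes_bump (e' : E) (s : Ioo 0 (Γ.len e')) :
    open scoped Classical in
    HasSlopes (fun x => bump x (.interior e' s))
      (fun e t => if e = e' then (if t < s then 1 else 0) - s / Γ.len e else 0)
      (fun e t => if e = e' then (if t ≤ s then 1 else 0) - s / Γ.len e else 0) := by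
  classical
  refine .of_eqOn_path (F := fun e t => if e = e' then min t s - t * s / Γ.len e else 0)
    (fun e t ht => bump_path_interior ht e' s) (fun e t ht => ?_) fun e t ht => ?_
  all_goals
    by_cases he : e = e'
    swap
    · simp only [he, if_false]
      exact hasDerivWithinAt_const _ _ _
    subst he
    simp only [if_true]
    refine hasDerivWithinAt_of_eventually_affine ?_
  · rcases lt_or_ge t s with h | h
    · filter_upwards [Icc_mem_nhdsGE h] with u hu
      rw [if_pos h, min_eq_left h.le, min_eq_left hu.2]
      ring
    · filter_upwards [self_mem_nhdsWithin] with u hu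
      rw [if_neg h.not_gt, min_eq_right h, min_eq_right (h.trans hu)]
      ring
  · rcases le_or_gt t s with h | h
    · filter_upwards [self_mem_nhdsWithin] with u hu
      rw [if_pos h, min_eq_left h, min_eq_left (le_trans hu h)]
      ring
    · filter_upwards [Icc_mem_nhdsLE h] with u hu
      rw [if_neg h.not_ge, min_eq_right h.le, min_eq_right hu.1]
      ring

/-- A unit current entering inside an edge leaves through its ends in the proportions 1 − s/L and
s/L, the values at y of the hat functions of these ends. If y is a vertex, both terms on the right
cancel. -/
theorem slopeSum_bump_vertex [Fintype E] (y : Γ.Point) (v : V) :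
    Γ.slopeSum (fun x => bump x y) (.vertex v) = open scoped Classical in
      interp (fun u => if u = v then 1 else 0) y - if y = .vertex v then 1 else 0 := by
  classical
  cases y with
  | vertex w =>
    simp only [bump_vertex, slopeSum_const, interp, Point.vertex.injEq, sub_self]
  | interior e' s =>
    rw [(hasSlopes_bump e' s).slopeSum_vertex, Finset.sum_eq_single e']
    · have h1 := s.2.1
      have h2 := s.2.2
      simp only [if_true, h1, h2.not_ge, if_false, interp, reduceCtorEq]
      split_ifs <;> ring
    · intro e _ he
      simp [he]
    · simp

theorem slopeSum_bump_interior [Fintype E] (y : Γ.Point) (e : E) (t : Ioo 0 (Γ.len e)) :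
    Γ.slopeSum (fun x => bump x y) (.interior e t) = open scoped Classical in
      -if .interior e t = y then 1 else 0 := by
  classical
  cases y with
  | vertex w => simp [bump_vertex, slopeSum_const]
  | interior e' s =>
    rw [(hasSlopes_bump e' s).slopeSum_interior]
    by_cases he : e = e'
    · subst he
      simp only [if_true, Point.interior.injEq, heq_eq_eq, true_and, Subtype.ext_iff]
      rcases lt_trichotomy (t : ℝ) s with h | h | h
      · simp [h, h.le, h.ne]
      · simp only [h, lt_irrefl, le_refl, if_true, if_false]
        ring
      · simp [h.not_gt, h.not_ge, h.ne']
    · simp [he]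

/-- The Green function of `Γ` extending the Green function `g` on the vertices. -/
def green (g : V → V → ℝ) (x y : Γ.Point) : ℝ := interp (fun u => interp (g u) y) x + bump x y

theorem isPiecewiseAffine_green (g : V → V → ℝ) (y : Γ.Point) :
    Γ.IsPiecewiseAffine fun x => green g x y :=
  (isPiecewiseAffine_interp _).add (isPiecewiseAffine_bump y)

theorem slopeSum_green_interior [Fintype E] (g : V → V → ℝ) (y : Γ.Point) (e : E)
    (t : Ioo 0 (Γ.len e)) : Γ.slopeSum (fun x => green g x y) (.interior e t) = open scoped Classical in
      -if .interior e t = y then 1 else 0 := by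
  have := slopeSum_add (isPiecewiseAffine_interp (Γ := Γ) fun u => interp (g u) y)
    (isPiecewiseAffine_bump y) (.interior e t)
  rw [slopeSum_interp_interior, slopeSum_bump_interior, zero_add] at this
  exact this

theorem Connected.isVoltage_unique [Finite V] [Fintype E] (hΓ : Γ.Connected) {z y : Γ.Point}
    {f f' : Γ.Point → ℝ} (hf : Γ.IsVoltage z y f) (hf' : Γ.IsVoltage z y f') : f = f' := by
  have := Fintype.ofFinite V
  have h2 := hf'.1.const_mul (-1)
  ext x
  have := hΓ.eq_of_slopeSum_eq_zero (hf.1.add h2) (fun x => by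
    rw [slopeSum_add hf.1 h2, slopeSum_const_mul hf'.1]
    have h3 := hf.2.2 x
    have h4 := hf'.2.2 x
    linarith) x z
  rw [hf.2.1, hf'.2.1] at this
  linarith

section Green

variable [Fintype V] [Fintype E] {g : V → V → ℝ}

theorem IsGreen.green_comm (hg : Γ.IsGreen g) (x y : Γ.Point) :
    green g x y = green g y x := by
  rw [green, green, bump_comm]
  congr 1
  cases x <;> cases y <;> simp only [interp]
  case vertex.vertex => exact hg.symm _ _
  case vertex.interior => rw [hg.symm, hg.symm _ (Γ.tgt _)]
  case interior.vertex => rw [hg.symm, hg.symm (Γ.tgt _)]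
  case interior.interior e t e' s =>
    rw [hg.symm (Γ.src e') (Γ.src e), hg.symm (Γ.src e') (Γ.tgt e), hg.symm (Γ.tgt e') (Γ.src e),
      hg.symm (Γ.tgt e') (Γ.tgt e)]
    ring

theorem IsGreen.lap_interp (hg : Γ.IsGreen g) (y : Γ.Point) (v : V) :
    Γ.lap (fun u => interp (g u) y) v = open scoped Classical in
      interp (fun u => if u = v then 1 else 0) y - 1 / Fintype.card V := by
  classical
  cases y with
  | vertex w =>
    simp only [interp]
    simp_rw [hg.symm _ w]
    exact hg.lap_eq w v
  | interior e t =>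
    simp only [interp]
    simp_rw [hg.symm _ (Γ.src e), hg.symm _ (Γ.tgt e)]
    rw [lap_linear, hg.lap_eq, hg.lap_eq]
    ring

/-- The hat-function terms of the interpolated part and of the bump cancel, leaving the mass at y
and the uniform background. -/
theorem IsGreen.slopeSum_green_vertex (hg : Γ.IsGreen g) (y : Γ.Point) (v : V) :
    Γ.slopeSum (fun x => green g x y) (.vertex v) = open scoped Classical in
      (1 : ℝ) / Fintype.card V - if .vertex v = y then 1 else 0 := by
  classical
  have := slopeSum_add (isPiecewiseAffine_interp (Γ := Γ) fun u => interp (g u) y)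
    (isPiecewiseAffine_bump y) (.vertex v)
  rw [slopeSum_interp_vertex, slopeSum_bump_vertex, hg.lap_interp] at this
  simp only [eq_comm (b := y)]
  refine this.trans ?_
  ring

/-- The backgrounds cancel in the difference of two Green functions; the terms without x normalize
the value at z to 0. -/
theorem IsGreen.isVoltage (hg : Γ.IsGreen g) (z y : Γ.Point) :
    Γ.IsVoltage z y fun x => green g x y - green g x z - green g z y + green g z z := by
  classical
  have h1 := isPiecewiseAffine_green g y
  have h2 := (isPiecewiseAffine_green g z).const_mul (-1)
  have h3 := IsPiecewiseAffine.const Γ (green g z z - green g z y)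
  have heq : (fun x => green g x y - green g x z - green g z y + green g z z) =
      fun x => green g x y + -1 * green g x z + (green g z z - green g z y) := by
    ext x
    ring
  rw [heq]
  refine ⟨(h1.add h2).add h3, by ring, fun p => ?_⟩
  rw [slopeSum_add (h1.add h2) h3, slopeSum_add h1 h2,
    slopeSum_const_mul (isPiecewiseAffine_green g z), slopeSum_const]
  cases p with
  | vertex v =>
    rw [hg.slopeSum_green_vertex, hg.slopeSum_green_vertex]
    ring
  | interior e t =>
    rw [slopeSum_green_interior, slopeSum_green_interior]
    ring

theorem IsGreen.voltage_eq (hg : Γ.IsGreen g) (hΓ : Γ.Connected) (z x y : Γ.Point) :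
    Γ.voltage z x y = green g x y - green g x z - green g z y + green g z z := by
  have h := hg.isVoltage z y
  rw [voltage, hΓ.isVoltage_unique (Classical.epsilon_spec (p := Γ.IsVoltage z y) ⟨_, h⟩) h]

theorem IsGreen.resistance_eq (hg : Γ.IsGreen g) (hΓ : Γ.Connected) (x y : Γ.Point) :
    Γ.resistance x y = green g x x - 2 * green g x y + green g y y := by
  rw [resistance, hg.voltage_eq hΓ, hg.green_comm y x]
  ring

theorem IsGreen.resistance_vertex (hg : Γ.IsGreen g) (hΓ : Γ.Connected) (u v : V) :
    Γ.resistance (.vertex u) (.vertex v) = vertexResistance g u v := by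
  rw [hg.resistance_eq hΓ]
  simp [green, interp, bump, vertexResistance]

end Green

end MetrizedGraph

/-! ### Elementary integrals -/

theorem intervalIntegral_quadratic (p q r a b : ℝ) :
    ∫ t in a..b, (p + q * t + r * t ^ 2) =
      p * (b - a) + q * (b ^ 2 - a ^ 2) / 2 + r * (b ^ 3 - a ^ 3) / 3 := by
  have h : ∀ t ∈ uIcc a b, HasDerivAt (fun t : ℝ => p * t + q / 2 * t ^ 2 + r / 3 * t ^ 3)
      (p + q * t + r * t ^ 2) t := fun t _ => by
    have h1 := (hasDerivAt_id t).const_mul p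
    have h2 := ((hasDerivAt_id t).pow 2).const_mul (q / 2)
    have h3 := ((hasDerivAt_id t).pow 3).const_mul (r / 3)
    refine ((h1.fun_add h2).fun_add h3).congr_deriv ?_
    push_cast
    simp only [id]
    ring
  rw [intervalIntegral.integral_eq_sub_of_hasDerivAt h
    (Continuous.intervalIntegrable (by fun_prop) _ _)]
  ring

theorem intervalIntegral_min_sub {L t : ℝ} (hL : 0 < L) (ht : t ∈ Icc 0 L) :
    ∫ s in (0 : ℝ)..L, (min t s - t * s / L) = t * (L - t) / 2 := by
  rw [← intervalIntegral.integral_add_adjacent_intervals (b := t)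
    (Continuous.intervalIntegrable (by fun_prop) _ _)
    (Continuous.intervalIntegrable (by fun_prop) _ _)]
  have h1 : ∫ s in (0 : ℝ)..t, (min t s - t * s / L) =
      ∫ s in (0 : ℝ)..t, (0 + (1 - t / L) * s + 0 * s ^ 2) :=
    intervalIntegral.integral_congr fun s hs => by
      rw [uIcc_of_le ht.1] at hs
      simp only [min_eq_right hs.2]
      ring
  have h2 : ∫ s in t..L, (min t s - t * s / L) =
      ∫ s in t..L, (t + -(t / L) * s + 0 * s ^ 2) :=
    intervalIntegral.integral_congr fun s hs => by
      rw [uIcc_of_le ht.2] at hs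
      simp only [min_eq_left hs.1]
      ring
  rw [h1, h2, intervalIntegral_quadratic, intervalIntegral_quadratic]
  field_simp
  ring

/-! ### Integration against signed measures -/

namespace MeasureTheory.SignedMeasure

variable {X : Type*} [MeasurableSpace X] (μ : SignedMeasure X)

instance : IsFiniteMeasure μ.variation := by
  rw [← totalVariation_eq_variation]
  exact inferInstanceAs (IsFiniteMeasure (_ + _))

/-- The Jordan decomposition turns an arbitrary canonical measure into two finite positive ones, to
which Fubini applies. -/
theorem integral_eq_sub {f : X → ℝ} (hf : ∀ m : Measure X, IsFiniteMeasure m → Integrable f m) :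
    ∫ᵛ x, f x ∂<•μ = ∫ x, f x ∂μ.toJordanDecomposition.posPart -
      ∫ x, f x ∂μ.toJordanDecomposition.negPart := by
  conv_lhs => rw [← μ.toSignedMeasure_toJordanDecomposition, JordanDecomposition.toSignedMeasure]
  rw [VectorMeasure.integral_sub_vectorMeasure (hf _ inferInstance) (hf _ inferInstance),
    VectorMeasure.integral_toSignedMeasure, VectorMeasure.integral_toSignedMeasure]

theorem integral_one : ∫ᵛ _, (1 : ℝ) ∂<•μ = μ univ := by
  rw [VectorMeasure.integral_const]
  simp

end MeasureTheory.SignedMeasure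

/-! ### Compactness, bounds and the Chinburg–Rumely measure -/

namespace MetrizedGraph

variable {V E : Type*} {Γ : MetrizedGraph V E}

instance [Finite V] [Finite E] : CompactSpace Γ.Point := by
  -- The vertices are listed separately because a one-vertex graph may have no edges.
  have h : (univ : Set Γ.Point) = (range fun v => Point.vertex v) ∪
      ⋃ e, Γ.path e '' Icc 0 (Γ.len e) := by
    refine (eq_univ_of_forall fun x => ?_).symm
    cases x with
    | vertex v => exact Or.inl ⟨v, rfl⟩
    | interior e t =>
      exact Or.inr (mem_iUnion.2 ⟨e, t, Ioo_subset_Icc_self t.2, path_coe Γ e t⟩)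
  refine ⟨?_⟩
  rw [h]
  exact (finite_range _).isCompact.union
    (isCompact_iUnion fun e => isCompact_Icc.image (continuous_path e))

theorem integrable_of_continuous [Finite V] [Finite E] {f : Γ.Point → ℝ} (hf : Continuous f)
    (m : Measure Γ.Point) [IsFiniteMeasure m] : Integrable f m := by
  obtain ⟨C, hC⟩ := isCompact_univ.exists_bound_of_continuousOn hf.continuousOn
  exact .of_bound hf.stronglyMeasurable.aestronglyMeasurable C
    (Filter.Eventually.of_forall fun x => hC x (mem_univ x))

theorem integral_linear [Finite V] [Finite E] (μ : SignedMeasure Γ.Point) {f f' : Γ.Point → ℝ}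
    (hf : Continuous f) (hf' : Continuous f') (a b : ℝ) :
    ∫ᵛ x, (a * f x + b * f' x) ∂<•μ = a * ∫ᵛ x, f x ∂<•μ + b * ∫ᵛ x, f' x ∂<•μ := by
  rw [VectorMeasure.integral_fun_add (integrable_of_continuous (hf.const_mul a) _)
    (integrable_of_continuous (hf'.const_mul b) _)]
  congr 1 <;> exact VectorMeasure.integral_fun_smul _ _ _ _

theorem abs_interp_le {a : V → ℝ} {C : ℝ} (h : ∀ v, |a v| ≤ C) (x : Γ.Point) :
    |interp a x| ≤ C := by
  cases x with
  | vertex v => exact h v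
  | interior e t =>
    have hL := Γ.len_pos e
    have h0 : 0 ≤ (t : ℝ) / Γ.len e := div_nonneg t.2.1.le hL.le
    have h1 : 0 ≤ 1 - (t : ℝ) / Γ.len e := by
      rw [sub_nonneg, div_le_one hL]
      exact t.2.2.le
    rw [interp]
    refine (abs_add_le _ _).trans ?_
    rw [abs_mul, abs_mul, abs_of_nonneg h0, abs_of_nonneg h1]
    nlinarith [h (Γ.src e), h (Γ.tgt e)]

/-- The Green function is shown continuous only in each variable and on the diagonal; this uniform
bound provides the domination for Fubini and for integrals depending on a parameter. -/
theorem exists_abs_green_le [Finite V] [Fintype E] (g : V → V → ℝ) :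
    ∃ C, ∀ x y : Γ.Point, |green g x y| ≤ C := by
  obtain ⟨C, hC⟩ := Finite.exists_le fun p : V × V => |g p.1 p.2|
  refine ⟨C + Γ.totalLength, fun x y => (abs_add_le _ _).trans (add_le_add ?_ ?_)⟩
  · exact abs_interp_le (fun u => abs_interp_le (fun v => hC (u, v)) y) x
  · rw [abs_of_nonneg (bump_nonneg x y)]
    exact bump_le x y

theorem green_path_path (g : V → V → ℝ) (e : E) {t : ℝ} (ht : t ∈ Icc 0 (Γ.len e)) :
    green g (Γ.path e t) (Γ.path e t) =
      (1 - t / Γ.len e) * ((1 - t / Γ.len e) * g (Γ.src e) (Γ.src e) +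
        t / Γ.len e * g (Γ.src e) (Γ.tgt e)) +
      t / Γ.len e * ((1 - t / Γ.len e) * g (Γ.tgt e) (Γ.src e) +
        t / Γ.len e * g (Γ.tgt e) (Γ.tgt e)) + (t - t * t / Γ.len e) := by
  rw [green, interp_path _ e ht, interp_path _ e ht, interp_path _ e ht, bump_path_path ht ht,
    min_self]

theorem continuous_green_self (g : V → V → ℝ) : Continuous fun x : Γ.Point => green g x x :=
  continuous_of_eqOn_path (fun e => by fun_prop) fun e t ht => green_path_path g e ht

/-- Lebesgue measure on an edge. -/
def edgeMeasure (Γ : MetrizedGraph V E) (e : E) : Measure Γ.Point :=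
  Measure.map (Γ.path e) (volume.restrict (Ioc 0 (Γ.len e)))

instance (e : E) : IsFiniteMeasure (Γ.edgeMeasure e) := by
  unfold edgeMeasure
  infer_instance

theorem integral_edgeMeasure {f : Γ.Point → ℝ} (hf : Continuous f) (e : E) :
    ∫ x, f x ∂Γ.edgeMeasure e = ∫ t in (0 : ℝ)..Γ.len e, f (Γ.path e t) := by
  rw [edgeMeasure, integral_map (continuous_path e).measurable.aemeasurable
    hf.stronglyMeasurable.aestronglyMeasurable,
    intervalIntegral.integral_of_le (Γ.len_pos e).le]

/-- The density of the canonical measure on an edge. -/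
def density (Γ : MetrizedGraph V E) (g : V → V → ℝ) (e : E) : ℝ :=
  (Γ.len e - vertexResistance g (Γ.src e) (Γ.tgt e)) / Γ.len e ^ 2

theorem continuous_interp (a : V → ℝ) : Continuous fun x : Γ.Point => interp a x :=
  (isPiecewiseAffine_interp a).1

theorem continuous_bump (y : Γ.Point) : Continuous fun x => bump x y :=
  (isPiecewiseAffine_bump y).1

theorem continuous_green (g : V → V → ℝ) (y : Γ.Point) : Continuous fun x => green g x y :=
  (isPiecewiseAffine_green g y).1

section Charge

variable [Fintype E] (Γ)

/-- The point masses of the canonical measure. -/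
def charge (v : V) : ℝ :=
  open scoped Classical in
  1 - 1 / 2 * ∑ e, ((if Γ.src e = v then 1 else 0) + (if Γ.tgt e = v then 1 else 0))

variable [Fintype V]

/-- The formula of Chinburg and Rumely for the canonical measure. -/
def canon (g : V → V → ℝ) : SignedMeasure Γ.Point :=
  ∑ v, Γ.charge v • (Measure.dirac (Point.vertex v)).toSignedMeasure +
    ∑ e, Γ.density g e • (Γ.edgeMeasure e).toSignedMeasure

variable {Γ}

theorem sum_charge_mul (f : V → ℝ) :
    ∑ v, Γ.charge v * f v = ∑ v, f v - 1 / 2 * ∑ e, (f (Γ.src e) + f (Γ.tgt e)) := by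
  classical
  simp only [charge, sub_mul, one_mul, Finset.sum_sub_distrib, mul_assoc, Finset.sum_mul,
    ← Finset.mul_sum]
  rw [Finset.sum_comm]
  simp [add_mul, Finset.sum_add_distrib, ite_mul]

theorem integral_canon (g : V → V → ℝ) {f : Γ.Point → ℝ} (hf : Continuous f) :
    ∫ᵛ x, f x ∂<•Γ.canon g = ∑ v, Γ.charge v * f (.vertex v) +
      ∑ e, Γ.density g e * ∫ t in (0 : ℝ)..Γ.len e, f (Γ.path e t) := by
  rw [canon, VectorMeasure.integral_add_vectorMeasure (integrable_of_continuous hf _)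
    (integrable_of_continuous hf _),
    VectorMeasure.integral_finsetSum_vectorMeasure fun v _ => integrable_of_continuous hf _,
    VectorMeasure.integral_finsetSum_vectorMeasure fun v _ => integrable_of_continuous hf _]
  congr 1
  · refine Finset.sum_congr rfl fun v _ => ?_
    rw [VectorMeasure.integral_smul_vectorMeasure, VectorMeasure.integral_toSignedMeasure,
      integral_dirac' _ _ hf.stronglyMeasurable, smul_eq_mul]
  · refine Finset.sum_congr rfl fun e _ => ?_
    rw [VectorMeasure.integral_smul_vectorMeasure, VectorMeasure.integral_toSignedMeasure,
      integral_edgeMeasure hf, smul_eq_mul]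

end Charge

end MetrizedGraph

/-! ### The Chinburg–Rumely measure is canonical, and the constant is unique -/

namespace MetrizedGraph

variable {V E : Type*} [Fintype V] [Fintype E] {Γ : MetrizedGraph V E} {g : V → V → ℝ}

/-- The vertex masses add up to |V| − |E| and the edge masses to |E| − Σ r_e / L_e, so the total is
1 by Foster's theorem. -/
theorem IsGreen.sum_charge_add_sum_density (hg : Γ.IsGreen g) [Nonempty V] :
    ∑ v, Γ.charge v + ∑ e, Γ.density g e * Γ.len e = 1 := by
  have h1 := Γ.sum_charge_mul (fun _ => 1)
  have h2 : ∀ e, Γ.density g e * Γ.len e =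
      1 - vertexResistance g (Γ.src e) (Γ.tgt e) / Γ.len e := fun e => by
    have := (Γ.len_pos e).ne'
    rw [density]
    field_simp
  simp only [mul_one, Finset.sum_const, Finset.card_univ, nsmul_eq_mul] at h1
  simp only [h2, Finset.sum_sub_distrib, hg.sum_vertexResistance_div_len, h1, Finset.sum_const,
    Finset.card_univ, nsmul_eq_mul]
  ring

theorem IsGreen.canon_univ (hg : Γ.IsGreen g) [Nonempty V] : Γ.canon g univ = 1 := by
  rw [← SignedMeasure.integral_one, integral_canon g continuous_const]
  simpa using hg.sum_charge_add_sum_density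

theorem integral_canon_interp (g : V → V → ℝ) (a : V → ℝ) :
    ∫ᵛ x, interp a x ∂<•Γ.canon g = ∑ v, Γ.charge v * a v +
      ∑ e, Γ.density g e * (Γ.len e / 2 * (a (Γ.src e) + a (Γ.tgt e))) := by
  rw [integral_canon g (continuous_interp a)]
  congr 1
  refine Finset.sum_congr rfl fun e _ => ?_
  have hL := Γ.len_pos e
  have : ∫ t in (0 : ℝ)..Γ.len e, interp a (Γ.path e t) = ∫ t in (0 : ℝ)..Γ.len e,
      (a (Γ.src e) + (a (Γ.tgt e) - a (Γ.src e)) / Γ.len e * t + 0 * t ^ 2) :=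
    intervalIntegral.integral_congr fun t ht => by
      rw [uIcc_of_le hL.le] at ht
      simp only [interp_path a e ht]
      ring
  rw [this, intervalIntegral_quadratic]
  field_simp
  ring

theorem integral_canon_bump_vertex (g : V → V → ℝ) (v : V) :
    ∫ᵛ x, bump x (.vertex v) ∂<•Γ.canon g = 0 := by
  rw [integral_canon g (continuous_bump _)]
  simp [bump_vertex]

theorem integral_canon_bump_interior (g : V → V → ℝ) (e : E) (t : Ioo 0 (Γ.len e)) :
    ∫ᵛ x, bump x (.interior e t) ∂<•Γ.canon g =
      Γ.density g e * (t * (Γ.len e - t) / 2) := by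
  classical
  have hL := Γ.len_pos e
  rw [integral_canon g (continuous_bump _)]
  have h1 : ∀ v, bump (.vertex v) (Point.interior e t) = 0 := fun v => rfl
  simp only [h1, mul_zero, Finset.sum_const_zero, zero_add]
  rw [Finset.sum_eq_single e]
  · rw [← intervalIntegral_min_sub hL (Ioo_subset_Icc_self t.2)]
    congr 1
    refine intervalIntegral.integral_congr fun s hs => ?_
    rw [uIcc_of_le hL.le] at hs
    simp only [bump_path_interior hs, if_true, min_comm, mul_comm s]
  · intro e' _ he
    have : ∫ s in (0 : ℝ)..Γ.len e', bump (Γ.path e' s) (.interior e t) =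
        ∫ s in (0 : ℝ)..Γ.len e', (0 : ℝ) := intervalIntegral.integral_congr fun s hs => by
      rw [uIcc_of_le (Γ.len_pos e').le] at hs
      simp only [bump_path_interior hs, he, if_false]
    rw [this]
    simp
  · simp

/-- Reproducing property of a Green function. -/
theorem IsGreen.sum_mul_lap (hg : Γ.IsGreen g) (a : V → ℝ) (u : V) :
    ∑ v, g u v * Γ.lap a v = a u - (∑ v, a v) / Fintype.card V := by
  classical
  rw [sum_mul_lap_comm]
  simp only [hg.lap_eq, mul_sub, mul_ite, mul_one, mul_zero, Finset.sum_sub_distrib,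
    Finset.sum_ite_eq, Finset.mem_univ, if_true, ← Finset.sum_mul]
  ring

/-- `IsGreen` leaves an additive constant free, so row sums are not prescribed; symmetry still
forces them all to agree. -/
theorem IsGreen.sum_row (hg : Γ.IsGreen g) [Nonempty V] (u u' : V) :
    ∑ v, g u v = ∑ v, g u' v := by
  have h1 := hg.sum_mul_lap (g u') u
  have h2 := hg.sum_mul_lap (g u) u'
  rw [Γ.sum_mul_lap_comm] at h1
  rw [h1, hg.symm u' u] at h2
  have hcard : (Fintype.card V : ℝ) ≠ 0 := by exact_mod_cast Fintype.card_ne_zero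
  field_simp at h2
  linarith

/-- At the vertices, the potential of the canonical measure is half the diagonal of the Green
function up to a constant. -/
theorem IsGreen.exists_integral_canon_interp (hg : Γ.IsGreen g) [Nonempty V] :
    ∃ K, ∀ u, ∫ᵛ x, interp (g u) x ∂<•Γ.canon g = 1 / 2 * g u u + K := by
  classical
  obtain ⟨u₀⟩ := ‹Nonempty V›
  refine ⟨(∑ v, g u₀ v) / Fintype.card V - 1 / 2 * ((∑ v, g v v) / Fintype.card V), fun u => ?_⟩
  have h1 := hg.sum_mul_lap (fun v => g v v) u
  have h2 : ∀ e, Γ.density g e * (Γ.len e / 2 * (g u (Γ.src e) + g u (Γ.tgt e))) =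
      1 / 2 * (g u (Γ.src e) + g u (Γ.tgt e)) -
      1 / 2 * (vertexResistance g (Γ.src e) (Γ.tgt e) / Γ.len e *
        (g u (Γ.src e) + g u (Γ.tgt e))) := fun e => by
    have := (Γ.len_pos e).ne'
    rw [density]
    field_simp
  have h3 : ∑ v, g u v * ∑ e,
      ((if Γ.src e = v then vertexResistance g (Γ.src e) (Γ.tgt e) / Γ.len e else 0) +
        (if Γ.tgt e = v then vertexResistance g (Γ.src e) (Γ.tgt e) / Γ.len e else 0)) =
      ∑ e, vertexResistance g (Γ.src e) (Γ.tgt e) / Γ.len e * (g u (Γ.src e) + g u (Γ.tgt e)) := by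
    simp only [Finset.mul_sum]
    rw [Finset.sum_comm]
    refine Finset.sum_congr rfl fun e _ => ?_
    simp only [mul_add, mul_ite, mul_zero, Finset.sum_add_distrib, Finset.sum_ite_eq,
      Finset.mem_univ, if_true]
    ring
  -- Pairing the Laplacian of the diagonal with `g u` yields the sum Σ (r_e/L_e)(g u e⁻ + g u e⁺),
  -- which is exactly what remains in the integral once the half-degree charges cancel against part
  -- of the densities.
  simp only [hg.lap_diag, mul_sub (g u _), Finset.sum_sub_distrib, ← Finset.sum_mul] at h1
  rw [h3] at h1
  rw [integral_canon_interp, sum_charge_mul]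
  simp only [h2, Finset.sum_sub_distrib, ← Finset.mul_sum]
  rw [hg.sum_row u₀ u]
  linear_combination 1 / 2 * h1

theorem IsGreen.integral_canon_interp_interp (hg : Γ.IsGreen g) (y : Γ.Point) :
    ∫ᵛ x, interp (fun u => interp (g u) y) x ∂<•Γ.canon g =
      interp (fun v => ∫ᵛ x, interp (g v) x ∂<•Γ.canon g) y := by
  cases y with
  | vertex v =>
    simp only [interp]
    simp_rw [hg.symm _ v]
  | interior e t =>
    rw [interp, ← integral_linear _ (continuous_interp _) (continuous_interp _)]
    congr 1
    ext x
    cases x with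
    | vertex w => simp only [interp, hg.symm w]
    | interior e' s =>
      simp only [interp]
      rw [hg.symm (Γ.src e') (Γ.src e), hg.symm (Γ.src e') (Γ.tgt e),
        hg.symm (Γ.tgt e') (Γ.src e), hg.symm (Γ.tgt e') (Γ.tgt e)]
      ring

/-- Along an edge, G(y,y) exceeds the linear interpolation of its end values by t(L − t)(L − r)/L².
Half of this is the integral of the bump precisely because the density is (L − r)/L². -/
theorem IsGreen.exists_integral_canon_green (hg : Γ.IsGreen g) [Nonempty V] :
    ∃ K, ∀ y : Γ.Point, ∫ᵛ x, green g x y ∂<•Γ.canon g = 1 / 2 * green g y y + K := by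
  obtain ⟨K, hK⟩ := hg.exists_integral_canon_interp
  refine ⟨K, fun y => ?_⟩
  have h := integral_linear (Γ.canon g) (continuous_interp fun u => interp (g u) y)
    (continuous_bump y) 1 1
  simp only [one_mul] at h
  simp only [green]
  rw [h, hg.integral_canon_interp_interp]
  simp only [hK]
  cases y with
  | vertex v =>
    rw [integral_canon_bump_vertex, bump_vertex, interp, interp, interp, add_zero, add_zero]
  | interior e t =>
    have hL := (Γ.len_pos e).ne'
    rw [integral_canon_bump_interior, density, vertexResistance]
    simp only [interp, bump, if_true, min_self]
    rw [hg.symm (Γ.tgt e) (Γ.src e)]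
    field_simp
    ring

section Canonical

variable (hg : Γ.IsGreen g) (hΓ : Γ.Connected)
include hg hΓ

theorem IsGreen.resistance_comm (x y : Γ.Point) : Γ.resistance x y = Γ.resistance y x := by
  rw [hg.resistance_eq hΓ, hg.resistance_eq hΓ, hg.green_comm x y]
  ring

theorem IsGreen.continuous_resistance (y : Γ.Point) : Continuous fun x => Γ.resistance x y := by
  simp only [hg.resistance_eq hΓ]
  have := continuous_green_self (Γ := Γ) g
  have := continuous_green (Γ := Γ) g y
  fun_prop

theorem IsGreen.exists_abs_resistance_le : ∃ C, ∀ x y : Γ.Point, |Γ.resistance x y| ≤ C := by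
  obtain ⟨C, hC⟩ := exists_abs_green_le (Γ := Γ) g
  refine ⟨4 * C, fun x y => ?_⟩
  rw [hg.resistance_eq hΓ, abs_le]
  have h1 := abs_le.1 (hC x x)
  have h2 := abs_le.1 (hC x y)
  have h3 := abs_le.1 (hC y y)
  constructor <;> linarith

/-- In r(x,y) = G(x,x) − 2G(x,y) + G(y,y) the last term is cancelled by twice the ½ G(y,y) coming
from the middle one. -/
theorem IsGreen.exists_integral_canon_resistance :
    ∃ c, ∀ y : Γ.Point, ∫ᵛ x, Γ.resistance x y ∂<•Γ.canon g = c := by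
  have := hΓ.nonempty
  obtain ⟨K, hK⟩ := hg.exists_integral_canon_green
  refine ⟨∫ᵛ x, green g x x ∂<•Γ.canon g - 2 * K, fun y => ?_⟩
  have hd := continuous_green_self (Γ := Γ) g
  have hc := continuous_green (Γ := Γ) g y
  have h1 := integral_linear (Γ.canon g) (f := fun x => 1 * green g x x + -2 * green g x y)
    (by fun_prop)
    (continuous_const (y := green g y y)) 1 1
  rw [integral_linear (Γ.canon g) hd hc, hK, VectorMeasure.integral_const] at h1
  simp only [one_mul, ContinuousLinearMap.flip_apply, ContinuousLinearMap.lsmul_apply,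
    hg.canon_univ, one_smul] at h1
  have heq : (fun x => Γ.resistance x y) =
      fun x => green g x x + -2 * green g x y + green g y y := by
    ext x
    rw [hg.resistance_eq hΓ]
    ring
  rw [heq, h1]
  ring

theorem IsGreen.isCanonicalMeasure : Γ.IsCanonicalMeasure (Γ.canon g) :=
  have := hΓ.nonempty
  ⟨hg.canon_univ, hg.exists_integral_canon_resistance hΓ⟩

/-- Fubini for the Chinburg–Rumely measure against m, with the former written out as vertex sums and
edge integrals. -/
theorem IsGreen.integral_integral_resistance {c : ℝ}
    (hc : ∀ y : Γ.Point, ∫ᵛ x, Γ.resistance x y ∂<•Γ.canon g = c) (m : Measure Γ.Point)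
    [IsFiniteMeasure m] :
    ∑ v, Γ.charge v * ∫ y, Γ.resistance y (.vertex v) ∂m + ∑ e, Γ.density g e *
      ∫ t in (0 : ℝ)..Γ.len e, ∫ y, Γ.resistance y (Γ.path e t) ∂m = c * m.real univ := by
  obtain ⟨C, hC⟩ := hg.exists_abs_resistance_le hΓ
  have hmeas : ∀ e, Measurable
      (Function.uncurry fun (t : ℝ) (y : Γ.Point) => Γ.resistance y (Γ.path e t)) := fun e => by
    -- Continuity in the real parameter and measurability in y suffice for joint measurability.
    refine measurable_uncurry_of_continuous_of_measurable (fun y => ?_) fun t =>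
      (hg.continuous_resistance hΓ _).measurable
    simp only [hg.resistance_comm hΓ y]
    exact (hg.continuous_resistance hΓ y).comp (continuous_path e)
  have hint : ∀ e, Integrable
      (Function.uncurry fun (t : ℝ) (y : Γ.Point) => Γ.resistance y (Γ.path e t))
      ((volume.restrict (Ioc 0 (Γ.len e))).prod m) := fun e =>
    .of_bound (hmeas e).aestronglyMeasurable C (Filter.Eventually.of_forall fun p => hC _ _)
  have hswap : ∀ e, ∫ t in (0 : ℝ)..Γ.len e, ∫ y, Γ.resistance y (Γ.path e t) ∂m =
      ∫ y, (∫ t in (0 : ℝ)..Γ.len e, Γ.resistance y (Γ.path e t)) ∂m := fun e => by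
    simp only [intervalIntegral.integral_of_le (Γ.len_pos e).le]
    exact integral_integral_swap (hint e)
  have hint2 : ∀ e, Integrable
      (fun y => ∫ t in (0 : ℝ)..Γ.len e, Γ.resistance y (Γ.path e t)) m := fun e => by
    simp only [intervalIntegral.integral_of_le (Γ.len_pos e).le]
    exact (hint e).integral_prod_right
  have hintv : ∀ v, Integrable (fun y => Γ.resistance y (.vertex v)) m := fun v =>
    integrable_of_continuous (hg.continuous_resistance hΓ _) m
  have key : ∀ y, ∑ v, Γ.charge v * Γ.resistance y (.vertex v) + ∑ e, Γ.density g e *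
      ∫ t in (0 : ℝ)..Γ.len e, Γ.resistance y (Γ.path e t) = c := fun y => by
    rw [← hc y, integral_canon g (hg.continuous_resistance hΓ y)]
    simp only [hg.resistance_comm hΓ y]
  simp only [hswap, ← integral_const_mul]
  rw [← integral_finsetSum _ fun v _ => (hintv v).const_mul _,
    ← integral_finsetSum _ fun e _ => (hint2 e).const_mul _,
    ← integral_add (integrable_finsetSum _ fun v _ => (hintv v).const_mul _)
      (integrable_finsetSum _ fun e _ => (hint2 e).const_mul _)]
  simp only [key, integral_const, smul_eq_mul, mul_comm c]

/-- The constant does not depend on the choice of a canonical measure. -/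
theorem IsGreen.voltageAvg_eq {c : ℝ}
    (hc : ∀ y : Γ.Point, ∫ᵛ x, Γ.resistance x y ∂<•Γ.canon g = c) {μ : SignedMeasure Γ.Point}
    (hμ : Γ.IsCanonicalMeasure μ) (x : Γ.Point) : Γ.voltageAvg μ x x = c := by
  have := hΓ.nonempty
  obtain ⟨h1, c', hc'⟩ := hμ
  rw [hc' x]
  set P := μ.toJordanDecomposition.posPart
  set N := μ.toJordanDecomposition.negPart
  have hsub : ∀ y, ∫ x, Γ.resistance x y ∂P - ∫ x, Γ.resistance x y ∂N = c' := fun y => by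
    rw [← hc' y, voltageAvg]
    exact (μ.integral_eq_sub fun m _ =>
      integrable_of_continuous (hg.continuous_resistance hΓ y) m).symm
  have hmass : P.real univ - N.real univ = 1 := by
    rw [← h1, ← μ.integral_one, μ.integral_eq_sub fun m _ => integrable_const _]
    simp [P, N]
  have hP := hg.integral_integral_resistance hΓ hc P
  have hN := hg.integral_integral_resistance hΓ hc N
  have hcont : ∀ (m : Measure Γ.Point) [IsFiniteMeasure m] (e : E), IntervalIntegrable
      (fun t => ∫ y, Γ.resistance y (Γ.path e t) ∂m) volume 0 (Γ.len e) := fun m _ e => by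
    obtain ⟨C, hC⟩ := hg.exists_abs_resistance_le hΓ
    refine Continuous.intervalIntegrable (continuous_of_dominated (bound := fun _ => C)
      (fun t => (hg.continuous_resistance hΓ _).stronglyMeasurable.aestronglyMeasurable)
      (fun t => Filter.Eventually.of_forall fun y => hC _ _) (integrable_const _)
      (Filter.Eventually.of_forall fun y => ?_)) _ _
    simp only [hg.resistance_comm hΓ y]
    exact (hg.continuous_resistance hΓ y).comp (continuous_path e)
  have hedge : ∀ e, (∫ t in (0 : ℝ)..Γ.len e, ∫ y, Γ.resistance y (Γ.path e t) ∂P) -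
      (∫ t in (0 : ℝ)..Γ.len e, ∫ y, Γ.resistance y (Γ.path e t) ∂N) = c' * Γ.len e := fun e => by
    rw [← intervalIntegral.integral_sub (hcont P e) (hcont N e)]
    simp only [hsub, intervalIntegral.integral_const, sub_zero, smul_eq_mul, mul_comm]
  -- Integrating first against μ = P − N gives c' times the mass of the Chinburg–Rumely measure; the
  -- other order, `hP` and `hN`, gives c times the mass of μ.
  have hfin : ∑ v, Γ.charge v * c' + ∑ e, Γ.density g e * (c' * Γ.len e) = c := by
    rw [← mul_one c, ← hmass, mul_sub, ← hP, ← hN, add_sub_add_comm, ← Finset.sum_sub_distrib,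
      ← Finset.sum_sub_distrib]
    simp only [← mul_sub, hsub, hedge]
  have hmul : ∑ e, Γ.density g e * (c' * Γ.len e) = (∑ e, Γ.density g e * Γ.len e) * c' := by
    rw [Finset.sum_mul]
    exact Finset.sum_congr rfl fun e _ => by ring
  rw [← hfin, hmul, ← Finset.sum_mul, ← add_mul, hg.sum_charge_add_sum_density, one_mul]

end Canonical

end MetrizedGraph

/-! ### The tau constant in terms of vertex resistances -/

namespace MetrizedGraph

variable {V E : Type*} [Fintype V] [Fintype E] {Γ : MetrizedGraph V E} {g : V → V → ℝ}

section Tau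

variable (hg : Γ.IsGreen g) (hΓ : Γ.Connected)
include hg hΓ

/-- Whichever canonical measure is chosen in `canonicalMeasure`, its constant is c, so no uniqueness
of the measure is needed. -/
theorem IsGreen.tau_eq_half {c : ℝ}
    (hc : ∀ y : Γ.Point, ∫ᵛ x, Γ.resistance x y ∂<•Γ.canon g = c) : Γ.tau = 1 / 2 * c := by
  have hμ : Γ.IsCanonicalMeasure Γ.canonicalMeasure :=
    Classical.epsilon_spec (p := Γ.IsCanonicalMeasure) ⟨_, hg.isCanonicalMeasure hΓ⟩
  have h : ∀ x, 1 / 2 * Γ.voltageAvg Γ.canonicalMeasure x x = 1 / 2 * c := fun x => by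
    rw [hg.voltageAvg_eq hΓ hc hμ x]
  obtain ⟨v⟩ := hΓ.nonempty
  have := Classical.epsilon_spec
    (p := fun t => ∀ x, 1 / 2 * Γ.voltageAvg Γ.canonicalMeasure x x = t) ⟨_, h⟩ (.vertex v)
  rw [h] at this
  exact this.symm

theorem IsGreen.resistance_path_vertex (p : V) (e : E) {t : ℝ} (ht : t ∈ Icc 0 (Γ.len e)) :
    Γ.resistance (Γ.path e t) (.vertex p) =
      (1 - t / Γ.len e) * vertexResistance g p (Γ.src e) +
        t / Γ.len e * vertexResistance g p (Γ.tgt e) + Γ.density g e * (t * (Γ.len e - t)) := by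
  have hL := (Γ.len_pos e).ne'
  rw [hg.resistance_eq hΓ, green_path_path g e ht, green, interp_path _ e ht, bump_vertex, green,
    bump_vertex]
  simp only [interp, density, vertexResistance]
  rw [hg.symm (Γ.tgt e) (Γ.src e), hg.symm (Γ.src e) p, hg.symm (Γ.tgt e) p]
  field_simp
  ring

/-- On each edge the resistance to p is an affine function plus density · t(L − t). The affine part
combines with the half-degree charges into the r_e / L_e sum; the parabola contributes density² ·
L³/6. -/
theorem IsGreen.integral_canon_resistance_vertex (p : V) :
    ∫ᵛ x, Γ.resistance x (.vertex p) ∂<•Γ.canon g =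
      ∑ v, vertexResistance g p v - 1 / 2 * ∑ e,
        vertexResistance g (Γ.src e) (Γ.tgt e) / Γ.len e *
          (vertexResistance g p (Γ.src e) + vertexResistance g p (Γ.tgt e)) +
      1 / 6 * ∑ e, (Γ.len e - vertexResistance g (Γ.src e) (Γ.tgt e)) ^ 2 / Γ.len e := by
  rw [integral_canon g (hg.continuous_resistance hΓ _)]
  have h1 : ∀ v, Γ.resistance (.vertex v) (.vertex p) = vertexResistance g p v := fun v => by
    rw [hg.resistance_comm hΓ, hg.resistance_vertex hΓ]
  simp only [h1, sum_charge_mul]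
  rw [sub_add, sub_add, Finset.mul_sum, Finset.mul_sum, Finset.mul_sum, ← Finset.sum_sub_distrib,
    ← Finset.sum_sub_distrib]
  congr 1
  refine Finset.sum_congr rfl fun e _ => ?_
  have hL := Γ.len_pos e
  have : ∫ t in (0 : ℝ)..Γ.len e, Γ.resistance (Γ.path e t) (.vertex p) =
      ∫ t in (0 : ℝ)..Γ.len e, (vertexResistance g p (Γ.src e) +
        ((vertexResistance g p (Γ.tgt e) - vertexResistance g p (Γ.src e)) / Γ.len e +
          Γ.density g e * Γ.len e) * t + -Γ.density g e * t ^ 2) :=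
    intervalIntegral.integral_congr fun t ht => by
      rw [uIcc_of_le hL.le] at ht
      simp only [hg.resistance_path_vertex hΓ p e ht]
      ring
  rw [this, intervalIntegral_quadratic, density]
  field_simp
  ring

theorem IsGreen.tau_eq (p : V) :
    Γ.tau = 1 / 2 * (∑ v, vertexResistance g p v - 1 / 2 * ∑ e,
        vertexResistance g (Γ.src e) (Γ.tgt e) / Γ.len e *
          (vertexResistance g p (Γ.src e) + vertexResistance g p (Γ.tgt e)) +
      1 / 6 * ∑ e, (Γ.len e - vertexResistance g (Γ.src e) (Γ.tgt e)) ^ 2 / Γ.len e) := by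
  obtain ⟨c, hc⟩ := hg.exists_integral_canon_resistance hΓ
  rw [hg.tau_eq_half hΓ hc, ← hg.integral_canon_resistance_vertex hΓ p, hc]

/-- By the parallel law r = LR/(L + R). For a bridge r = L, matching L²/∞ = 0. -/
theorem IsGreen.toReal_div_len_add_coResistance [DecidableEq E] (e : E) :
    (ENNReal.ofReal (Γ.len e) ^ 2 /
      (ENNReal.ofReal (Γ.len e) + Γ.coResistance e)).toReal =
      Γ.len e - vertexResistance g (Γ.src e) (Γ.tgt e) := by
  have hL := Γ.len_pos e
  by_cases h : (Γ.deleteEdge e).Connected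
  · obtain ⟨g', hg'⟩ := h.exists_isGreen
    have hpar := hg.vertexResistance_deleteEdge hg'
    have hR := hg'.vertexResistance_nonneg (Γ.src e) (Γ.tgt e)
    have hres := hg'.resistance_vertex h (Γ.src e) (Γ.tgt e)
    rw [coResistance, if_pos h, hres, ← ENNReal.ofReal_add hL.le hR, ENNReal.toReal_div,
      ENNReal.toReal_pow, ENNReal.toReal_ofReal hL.le, ENNReal.toReal_ofReal (by linarith)]
    have hne : Γ.len e + vertexResistance g' (Γ.src e) (Γ.tgt e) ≠ 0 := by positivity
    rw [div_eq_iff hne]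
    linear_combination -hpar
  · rw [hg.vertexResistance_of_not_connected hΓ h, coResistance, if_neg h]
    simp

end Tau

end MetrizedGraph

end

/-! ### Comparison of Γ with Γ^{DA,n} -/

open MetrizedGraph in
/-- The summand `L_e² / (L_e + R_e)` is computed in `[0, ∞]`; it is `0` if `R_e = ∞`. -/
theorem mainTheorem5 {V E : Type*} [Fintype V] [Fintype E] [DecidableEq E]
    (Γ : MetrizedGraph V E) (hΓ : Γ.Connected) (n : ℕ) (hn : 2 ≤ n) :
    (Γ.multiplyEdges n).tau =
      Γ.tau / (n : ℝ) ^ 2 + Γ.totalLength / 12 * (((n : ℝ) - 1) / n) ^ 2 +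
        ((n : ℝ) - 1) / (6 * (n : ℝ) ^ 2) *
          ∑ e : E, (ENNReal.ofReal (Γ.len e) ^ 2 /
            (ENNReal.ofReal (Γ.len e) + Γ.coResistance e)).toReal := by
  have hn0 : n ≠ 0 := by omega
  have hn' : (n : ℝ) ≠ 0 := by exact_mod_cast hn0
  obtain ⟨g, hg⟩ := hΓ.exists_isGreen
  obtain ⟨p⟩ := hΓ.nonempty
  have hvr : ∀ u v, vertexResistance (fun u v => g u v / (n : ℝ) ^ 2) u v =
      vertexResistance g u v / (n : ℝ) ^ 2 := fun u v => by
    unfold vertexResistance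
    ring
  rw [(hg.multiplyEdges hn0).tau_eq (hΓ.multiplyEdges hn0) p, hg.tau_eq hΓ p]
  simp only [hg.toReal_div_len_add_coResistance hΓ, hvr, ← Finset.sum_div]
  -- The n copies cancel the factor 1/n by which r_e / L_e shrinks, so only the 1/n² of the
  -- resistances to p survives.
  have h1 : ∑ e, vertexResistance g ((Γ.multiplyEdges n).src e) ((Γ.multiplyEdges n).tgt e) /
      (n : ℝ) ^ 2 / (Γ.multiplyEdges n).len e *
        (vertexResistance g p ((Γ.multiplyEdges n).src e) / (n : ℝ) ^ 2 +
          vertexResistance g p ((Γ.multiplyEdges n).tgt e) / (n : ℝ) ^ 2) =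
      (∑ e, vertexResistance g (Γ.src e) (Γ.tgt e) / Γ.len e *
        (vertexResistance g p (Γ.src e) + vertexResistance g p (Γ.tgt e))) / (n : ℝ) ^ 2 := by
    rw [Fintype.sum_prod_type, Finset.sum_div]
    refine Finset.sum_congr rfl fun e _ => ?_
    have := (Γ.len_pos e).ne'
    simp only [multiplyEdges, Finset.sum_const, Finset.card_univ, Fintype.card_fin, nsmul_eq_mul]
    field_simp
  -- Summing over the n copies gives (nL − r)²/(n²L), expanded through nL − r = (L − r) + (n − 1)L.
  have h2 : ∑ e, ((Γ.multiplyEdges n).len e - vertexResistance g ((Γ.multiplyEdges n).src e)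
      ((Γ.multiplyEdges n).tgt e) / (n : ℝ) ^ 2) ^ 2 / (Γ.multiplyEdges n).len e =
      (∑ e, (Γ.len e - vertexResistance g (Γ.src e) (Γ.tgt e)) ^ 2 / Γ.len e) / (n : ℝ) ^ 2 +
      ((n : ℝ) - 1) ^ 2 / (n : ℝ) ^ 2 * ∑ e, Γ.len e + 2 * ((n : ℝ) - 1) / (n : ℝ) ^ 2 *
        ∑ e, (Γ.len e - vertexResistance g (Γ.src e) (Γ.tgt e)) := by
    rw [Fintype.sum_prod_type, Finset.sum_div, Finset.mul_sum, Finset.mul_sum,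
      ← Finset.sum_add_distrib, ← Finset.sum_add_distrib]
    refine Finset.sum_congr rfl fun e _ => ?_
    have := (Γ.len_pos e).ne'
    simp only [multiplyEdges, Finset.sum_const, Finset.card_univ, Fintype.card_fin, nsmul_eq_mul]
    field_simp
    ring
  rw [h1, h2, totalLength]
  field_simp
  ring
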